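/- Let $q$ be an odd prime power, let $G=SL_2(\mathbb{F}_q)$, and let $R(G)$ be the ring generated by the isomorphism classes of finite-dimensional complex representations of $G$, with addition given by the direct sum $\oplus$ and multiplication by the tensor product $\otimes$. For an integer $k\ge 0$ let $F^k\subseteq R(G)$ be the subgroup spanned by the classes of those irreducible representations (irreps) that occur in some $\ell$-fold tensor product, $0\le \ell\le k$, of irreps of $G$ of dimension $\frac{q-1}{2}$ or $\frac{q+1}{2}$; the $0$-fold tensor product is the trivial representation. A representation $\rho$ of $G$ has tensor rank $k$ if its class lies in $F^k$ and, when $k\ge 1$, not in $F^{k-1}$. Then: 1. $F^2=R(G)$. Hence every irrep of $G$ has tensor rank $0$, $1$ or $2$. 2. An irrep of $G$ has tensor rank $0$ if and only if it is the trivial representation. 3. If $q>3$, then there are, up to isomorphism, exactly four irreps of $G$ of dimension $\frac{q\pm1}{2}$; an irrep of $G$ has tensor rank $1$ if and only if its dimension is $\frac{q-1}{2}$ or $\frac{q+1}{2}$, and it has tensor rank $2$ if and only if its dimension is $q-1$, $q$ or $q+1$. -/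

import Mathlib

open CategoryTheory MonoidalCategory Limits

namespace TensorRank

noncomputable section

universe u

/-- The commutative ring freely spanned over `ℤ` by the isomorphism classes of finite-dimensional
complex representations of `G`, multiplied by the tensor product
(in `Skeleton`, the product of the classes of `V` and `W` is the class of `V ⊗ W`). -/
abbrev FreeRepRing (G : Type u) [Group G] : Type (max 1 u) :=
  MonoidAlgebra ℤ (Skeleton (FDRep ℂ G))

/-- The generator attached to the isomorphism class of `V`. -/
def freeClass {G : Type u} [Group G] (V : FDRep ℂ G) : FreeRepRing G :=
  MonoidAlgebra.of ℤ (Skeleton (FDRep ℂ G)) (toSkeleton V)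

/-- The relations identifying addition with direct sum. -/
def directSumIdeal (G : Type u) [Group G] : Ideal (FreeRepRing G) :=
  Ideal.span {x | ∃ V W : FDRep ℂ G, x = freeClass (V ⊞ W) - (freeClass V + freeClass W)}

/-- The (complex) representation ring `R(G)`: addition is direct sum, multiplication is tensor
product. -/
abbrev RepRing (G : Type u) [Group G] : Type (max 1 u) :=
  FreeRepRing G ⧸ directSumIdeal G

/-- The class of a representation in `R(G)`. -/
def repClass {G : Type u} [Group G] (V : FDRep ℂ G) : RepRing G :=
  Ideal.Quotient.mk (directSumIdeal G) (freeClass V)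

/-- The tensor product of a list of representations; the empty product is the trivial
representation. -/
def tensorList {G : Type u} [Group G] (L : List (FDRep ℂ G)) : FDRep ℂ G :=
  L.foldr (fun V W => V ⊗ W) (𝟙_ (FDRep ℂ G))

/-- `G = SL₂(F)`. -/
abbrev SL2 (F : Type u) [Field F] : Type u :=
  Matrix.SpecialLinearGroup (Fin 2) F

/-- The irreducible representations of `SL₂(F_q)` of dimension `(q ± 1) / 2`. The divisions in `ℕ`
are exact when `q` is odd. -/
def IsHalfIrrep {F : Type u} [Field F] (V : FDRep ℂ (SL2 F)) : Prop :=
  Simple V ∧ (Module.finrank ℂ V = (Nat.card F - 1) / 2 ∨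
    Module.finrank ℂ V = (Nat.card F + 1) / 2)

/-- The `k`-th step of the tensor rank filtration: the subgroup of `R(SL₂(F_q))` spanned by the
classes of the irreducible representations that occur in some `ℓ`-fold tensor product, `ℓ ≤ k`, of
irreducible representations of dimension `(q ± 1) / 2`. -/
def tensorFiltration (F : Type u) [Field F] (k : ℕ) : AddSubgroup (RepRing (SL2 F)) :=
  AddSubgroup.closure {x | ∃ (W : FDRep ℂ (SL2 F)) (L : List (FDRep ℂ (SL2 F))),
    Simple W ∧ L.length ≤ k ∧ (∀ V ∈ L, IsHalfIrrep V) ∧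
    (∃ f : W ⟶ tensorList L, Mono f) ∧ x = repClass W}

/-- `V` has tensor rank `k`: its class lies in the `k`-th step of the filtration and, if `k > 0`,
not in the `(k - 1)`-st step. -/
def HasTensorRank {F : Type u} [Field F] (V : FDRep ℂ (SL2 F)) (k : ℕ) : Prop :=
  repClass V ∈ tensorFiltration F k ∧ ∀ j, k = j + 1 → repClass V ∉ tensorFiltration F j

end

end TensorRank


/-!
Let `U` and `B` be the unipotent and Borel subgroups of `G = SL₂(F_q)`, let `ψ` be a primitive
additive character of `F_q` and `ε` a nonsquare. For a representation `V` let `m_a(V)` be the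
multiplicity of `x ↦ ψ(a x)` in `V|U`. For `a ≠ 0` it depends only on the square class of `a`, so
`2 dim V = 2 m_0(V) + (q - 1) (m_1(V) + m_ε(V))`, and it is at most one on irreducibles (Gelfand's
trick, for the anti-involution of `G` exchanging the diagonal entries).

Column orthogonality and the Bruhat decomposition evaluate the sums of products of these
multiplicities, and of multiplicities of characters of `B`, over all irreducibles. In particular
`∑ (m_1 - m_ε)² = 4`. The nontrivial irreducibles with `m_1 ≠ m_ε` have dimension `(q ± 1) / 2`, and
the other nontrivial ones have `m_1 = m_ε = 1`, with `m_0 = 0`, `1` or `2` in dimension `q - 1`,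
`q` or `q + 1`.

If `m_1(V) = m_ε(V) = 1`, then `m_c(V ⊗ X) = (m_0(V) - 1) m_c(X) + dim X`. When `m_0(V) ≠ 1` and
`X` has dimension `(q ± 1) / 2`, this forces `m_1 ≠ m_ε` on some constituent `Y` of `V ⊗ X`, so that
`V` occurs in `Y ⊗ X*` with `Y` and `X*` of dimension `(q ± 1) / 2`. When `m_0(V) = 1`, the
representation `V` contains a `B`-fixed line, and one takes for `X` an irreducible containing the
quadratic character of `B`: then `V ⊗ X` again contains that character, hence so does one of its
constituents `Y`.
-/

namespace TensorRank

noncomputable section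

universe u v

section Basic

variable {k : Type u} [Field k] {G : Type v} [Group G]

/-- The linear map underlying a morphism of representations. -/
def homLin {V W : FDRep k G} (f : V ⟶ W) : V →ₗ[k] W := f.hom.hom.hom

@[simp] lemma homLin_comp {U V W : FDRep k G} (f : U ⟶ V) (g : V ⟶ W) :
    homLin (f ≫ g) = homLin g ∘ₗ homLin f := rfl

@[simp] lemma homLin_id (V : FDRep k G) : homLin (𝟙 V) = LinearMap.id := rfl

@[simp] lemma homLin_add {V W : FDRep k G} (f g : V ⟶ W) :
    homLin (f + g) = homLin f + homLin g := rfl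

@[simp] lemma homLin_zero {V W : FDRep k G} : homLin (0 : V ⟶ W) = 0 := rfl

lemma homLin_comp_rho {V W : FDRep k G} (f : V ⟶ W) (g : G) :
    homLin f ∘ₗ V.ρ g = W.ρ g ∘ₗ homLin f :=
  congrArg (fun h => h.hom.hom) (f.comm g)

lemma homLin_injective {V W : FDRep k G} :
    Function.Injective (homLin : (V ⟶ W) → (V →ₗ[k] W)) := fun _ _ h =>
  Action.Hom.ext (InducedCategory.hom_ext (ModuleCat.hom_ext h))

lemma injective_homLin {V W : FDRep k G} (f : V ⟶ W) [Mono f] :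
    Function.Injective (homLin f) :=
  (Rep.mono_iff_injective ((forget₂ (FDRep k G) (Rep k G)).map f)).1 inferInstance

/-- The morphism of representations given by an equivariant linear map. -/
def homOfLin {V W : FDRep k G} (f : V →ₗ[k] W) (hf : ∀ g, f ∘ₗ V.ρ g = W.ρ g ∘ₗ f) : V ⟶ W :=
  ⟨InducedCategory.homMk (ModuleCat.ofHom f), fun g =>
    InducedCategory.hom_ext (ModuleCat.hom_ext (hf g))⟩

lemma rho_inv_mul_rho (V : FDRep k G) (g : G) : V.ρ g⁻¹ * V.ρ g = 1 := by
  rw [← map_mul, inv_mul_cancel, map_one]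

lemma rho_mul_rho_inv (V : FDRep k G) (g : G) : V.ρ g * V.ρ g⁻¹ = 1 := by
  rw [← map_mul, mul_inv_cancel, map_one]

lemma finrank_eq_zero_iff (V : FDRep k G) : Module.finrank k V = 0 ↔ IsZero V := by
  rw [IsZero.iff_id_eq_zero, ← homLin_injective.eq_iff, homLin_id, homLin_zero,
    Module.finrank_zero_iff]
  refine ⟨fun _ => LinearMap.ext fun v => Subsingleton.elim _ _, fun h => ⟨fun v w => ?_⟩⟩
  rw [← LinearMap.id_apply (R := k) v, ← LinearMap.id_apply (R := k) w, h]
  rfl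

lemma finrank_pos_iff (V : FDRep k G) : 0 < Module.finrank k V ↔ ¬ IsZero V := by
  rw [← finrank_eq_zero_iff, Nat.pos_iff_ne_zero]

lemma finrank_pos_of_simple (V : FDRep k G) [Simple V] : 0 < Module.finrank k V :=
  (finrank_pos_iff V).2 (Simple.not_isZero V)

lemma finrank_eq_of_iso {V W : FDRep k G} (e : V ≅ W) : Module.finrank k V = Module.finrank k W :=
  (FDRep.isoToLinearEquiv e).finrank_eq

lemma char_of_isZero {V : FDRep k G} (h : IsZero V) (g : G) : V.character g = 0 := by
  have : Subsingleton V := Module.finrank_zero_iff.1 ((finrank_eq_zero_iff V).2 h)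
  rw [FDRep.character, Subsingleton.elim (V.ρ g) 0, map_zero]

lemma char_biprod (V W : FDRep k G) (g : G) :
    (V ⊞ W).character g = V.character g + W.character g := by
  have split : (V ⊞ W).ρ g =
      ((V ⊞ W).ρ g ∘ₗ homLin (biprod.inl : V ⟶ V ⊞ W)) ∘ₗ homLin biprod.fst +
      ((V ⊞ W).ρ g ∘ₗ homLin (biprod.inr : W ⟶ V ⊞ W)) ∘ₗ homLin biprod.snd := by
    rw [LinearMap.comp_assoc, LinearMap.comp_assoc, ← LinearMap.comp_add, ← homLin_comp,
      ← homLin_comp, ← homLin_add, biprod.total, homLin_id, LinearMap.comp_id]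
  unfold FDRep.character
  rw [split, map_add, LinearMap.trace_comp_comm' (homLin (biprod.fst : V ⊞ W ⟶ V)),
    LinearMap.trace_comp_comm' (homLin (biprod.snd : V ⊞ W ⟶ W)), ← homLin_comp_rho,
    ← homLin_comp_rho, ← LinearMap.comp_assoc, ← LinearMap.comp_assoc, ← homLin_comp,
    ← homLin_comp, biprod.inl_fst, biprod.inr_snd]
  simp

end Basic

section CompleteReducibility

variable {k : Type u} [Field k] [CharZero k] {G : Type v} [Group G]

lemma finrank_biprod (V W : FDRep k G) :
    Module.finrank k (V ⊞ W : FDRep k G) = Module.finrank k V + Module.finrank k W := by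
  have := char_biprod V W 1
  simp only [FDRep.char_one] at this
  exact_mod_cast this

variable [Finite G]

lemma isSplitMono_of_mono {V W : FDRep k G} (f : W ⟶ V) [Mono f] : IsSplitMono f := by
  let i := Representation.IntertwiningMap.equivLinearMapAsModule W.ρ V.ρ
    ⟨homLin f, homLin_comp_rho f⟩
  obtain ⟨r, hr⟩ := MonoidAlgebra.exists_leftInverse_of_injective i
    (LinearMap.ker_eq_bot.2 (injective_homLin f))
  let r' := (Representation.IntertwiningMap.equivLinearMapAsModule V.ρ W.ρ).symm r
  refine ⟨⟨⟨homOfLin r'.toLinearMap r'.isIntertwining', homLin_injective ?_⟩⟩⟩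
  ext w
  exact LinearMap.congr_fun hr w

lemma exists_iso_biprod_of_not_simple {V : FDRep k G} (h0 : ¬ IsZero V) (hV : ¬ Simple V) :
    ∃ W₁ W₂ : FDRep k G, Nonempty (V ≅ W₁ ⊞ W₂) ∧ ¬ IsZero W₁ ∧ ¬ IsZero W₂ := by
  obtain ⟨W, f, _, hf⟩ : ∃ (W : FDRep k G) (f : W ⟶ V), Mono f ∧ ¬ (IsIso f ↔ f ≠ 0) := by
    by_contra! H
    exact hV ⟨fun f hf => H _ f hf⟩
  have hf0 : f ≠ 0 := by
    rintro rfl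
    exact hf (iff_of_false (fun h => h0 ((isIsoZero_iff_source_target_isZero _ _).1 h).2)
      (fun h => h rfl))
  have : IsSplitMono f := isSplitMono_of_mono f
  refine ⟨W, cokernel f, ⟨biprod.uniqueUpToIso _ _
    (isBilimitBinaryBiconeOfIsSplitMonoOfCokernel (cokernelIsCokernel f))⟩,
    fun hW => hf0 (hW.eq_of_src _ _), fun hC => hf (iff_of_true ?_ hf0)⟩
  have : Epi f := Preadditive.epi_of_isZero_cokernel f hC
  exact isIso_of_mono_of_epi f

lemma rep_induction {P : FDRep k G → Prop}
    (iso : ∀ V W : FDRep k G, (V ≅ W) → P W → P V)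
    (zero : ∀ V : FDRep k G, IsZero V → P V)
    (simple : ∀ V : FDRep k G, Simple V → P V)
    (biprod : ∀ V W : FDRep k G, P V → P W → P (V ⊞ W)) (V : FDRep k G) : P V := by
  induction hn : Module.finrank k V using Nat.strong_induction_on generalizing V with
  | _ n ih =>
    by_cases h0 : IsZero V
    · exact zero V h0
    by_cases hV : Simple V
    · exact simple V hV
    obtain ⟨W₁, W₂, ⟨e⟩, hW₁, hW₂⟩ := exists_iso_biprod_of_not_simple h0 hV
    rw [← finrank_pos_iff] at hW₁ hW₂
    have hdim := finrank_eq_of_iso e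
    rw [finrank_biprod] at hdim
    exact iso _ _ e (biprod _ _ (ih _ (by omega) W₁ rfl) (ih _ (by omega) W₂ rfl))

end CompleteReducibility

section Characters

variable {k : Type u} [Field k] [CharZero k] [IsAlgClosed k] {G : Type v} [Group G]

lemma sum_conj_eq_smul_one [Fintype G] (V : FDRep k G) [Simple V] (A : Module.End k V) :
    ∑ g : G, V.ρ g * A * V.ρ g⁻¹ =
      ((Fintype.card G : k) * LinearMap.trace k V A / Module.finrank k V) •
        (1 : Module.End k V) := by
  set S : Module.End k V := ∑ g : G, V.ρ g * A * V.ρ g⁻¹ with hS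
  have S_comm (h : G) : S ∘ₗ V.ρ h = V.ρ h ∘ₗ S := by
    change S * V.ρ h = V.ρ h * S
    rw [hS, Finset.sum_mul, Finset.mul_sum]
    refine Fintype.sum_equiv (Equiv.mulLeft h⁻¹) _ _ fun x => ?_
    simp only [Equiv.coe_mulLeft, mul_inv_rev, inv_inv, map_mul, mul_assoc]
    rw [← mul_assoc (V.ρ h) (V.ρ h⁻¹), rho_mul_rho_inv, one_mul]
  obtain ⟨c, hc⟩ := endomorphism_simple_eq_smul_id k (homOfLin S S_comm)
  have S_eq : S = c • (1 : Module.End k V) := (congrArg homLin hc).symm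
  have trace_S : LinearMap.trace k V S = Fintype.card G * LinearMap.trace k V A := by
    have (g : G) : LinearMap.trace k V (V.ρ g * A * V.ρ g⁻¹) = LinearMap.trace k V A := by
      rw [LinearMap.trace_mul_comm, ← mul_assoc, rho_inv_mul_rho, one_mul]
    simp [hS, this]
  have hdim : (Module.finrank k V : k) ≠ 0 := by
    exact_mod_cast (finrank_pos_of_simple V).ne'
  rw [S_eq, map_smul, LinearMap.trace_one, smul_eq_mul] at trace_S
  rw [S_eq, ← trace_S, mul_div_cancel_right₀ _ hdim]

lemma char_mul_char_inv [Fintype G] (V : FDRep k G) [Simple V] (x y : G) :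
    V.character x * V.character y⁻¹ =
      (Fintype.card G : k)⁻¹ * ∑ g : G, (Module.finrank k V : k) *
        V.character (x * (g * y⁻¹ * g⁻¹)) := by
  have hdim : (Module.finrank k V : k) ≠ 0 := by
    exact_mod_cast (finrank_pos_of_simple V).ne'
  have average : ∑ g : G, V.character (x * (g * y⁻¹ * g⁻¹)) =
      Fintype.card G * V.character y⁻¹ / Module.finrank k V * V.character x := by
    simp only [FDRep.character, map_mul]
    rw [← map_sum, ← Finset.mul_sum, sum_conj_eq_smul_one, mul_smul_comm, mul_one, map_smul,
      smul_eq_mul]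
  rw [← Finset.mul_sum, average]
  field_simp

omit [IsAlgClosed k] in
lemma card_inv_mul_sum_char_mul_char [Fintype G] (V W : FDRep k G) :
    (Fintype.card G : k)⁻¹ * ∑ g : G, W.character g * V.character g⁻¹ =
      Module.finrank k (V ⟶ W) := by
  have := invertibleOfNonzero (NeZero.ne (Nat.card G : k))
  rw [← FDRep.scalar_product_char_eq_finrank_equivariant, Nat.card_eq_fintype_card]

omit [IsAlgClosed k] in
lemma finrank_hom_biprod_right [Finite G] (V W₁ W₂ : FDRep k G) :
    Module.finrank k (V ⟶ W₁ ⊞ W₂) = Module.finrank k (V ⟶ W₁) + Module.finrank k (V ⟶ W₂) := by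
  have := Fintype.ofFinite G
  have h := card_inv_mul_sum_char_mul_char V (W₁ ⊞ W₂)
  simp only [char_biprod, add_mul, Finset.sum_add_distrib, mul_add,
    card_inv_mul_sum_char_mul_char] at h
  exact_mod_cast h.symm

omit [IsAlgClosed k] in
lemma finrank_hom_comm [Finite G] (V W : FDRep k G) :
    Module.finrank k (V ⟶ W) = Module.finrank k (W ⟶ V) := by
  have := Fintype.ofFinite G
  have h := card_inv_mul_sum_char_mul_char V W
  rw [← Equiv.sum_comp (Equiv.inv G)] at h
  simp only [Equiv.inv_apply, inv_inv, mul_comm (W.character _)] at h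
  rw [card_inv_mul_sum_char_mul_char] at h
  exact_mod_cast h.symm

omit [IsAlgClosed k] in
lemma finrank_hom_congr_right [Finite G] (V : FDRep k G) {W W' : FDRep k G} (e : W ≅ W') :
    Module.finrank k (V ⟶ W) = Module.finrank k (V ⟶ W') := by
  have := Fintype.ofFinite G
  have h := card_inv_mul_sum_char_mul_char V W
  rw [FDRep.char_iso e, card_inv_mul_sum_char_mul_char] at h
  exact_mod_cast h.symm

end Characters

section Irreducibles

variable (k : Type u) [Field k] (G : Type v) [Group G]

/-- The set of isomorphism classes of irreducible representations of `G` over `k`. -/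
def Irr : Type (max (u + 1) v) :=
  {s : Skeleton (FDRep k G) // Simple ((fromSkeleton (FDRep k G)).obj s)}

variable {k G}

/-- A representative of an isomorphism class of irreducible representations. -/
def irrep (i : Irr k G) : FDRep k G := (fromSkeleton (FDRep k G)).obj i.1

instance (i : Irr k G) : Simple (irrep i) := i.2

lemma exists_iso_irrep (V : FDRep k G) [Simple V] : ∃ i : Irr k G, Nonempty (V ≅ irrep i) :=
  ⟨⟨toSkeleton V, Simple.of_iso (fromSkeletonToSkeletonIso V)⟩,
    ⟨(fromSkeletonToSkeletonIso V).symm⟩⟩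

lemma nonempty_irrep_iso_iff {i j : Irr k G} : Nonempty (irrep i ≅ irrep j) ↔ i = j := by
  refine ⟨fun h => Subtype.ext ?_, fun h => h ▸ ⟨Iso.refl _⟩⟩
  rw [← toSkeleton_fromSkeleton_obj i.1, ← toSkeleton_fromSkeleton_obj j.1]
  exact toSkeleton_eq_toSkeleton_iff.2 h

variable [IsAlgClosed k]

open Classical in
lemma finrank_hom_irrep (i j : Irr k G) :
    Module.finrank k (irrep i ⟶ irrep j) = if i = j then 1 else 0 := by
  rw [FDRep.finrank_hom_simple_simple]
  simp only [nonempty_irrep_iso_iff]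

variable [CharZero k]

lemma linearIndependent_char_irrep [Finite G] :
    LinearIndependent k fun i : Irr k G => (irrep i).character := by
  classical
  have := Fintype.ofFinite G
  rw [linearIndependent_iff']
  intro s c hc i hi
  have pairing (j : Irr k G) : (Fintype.card G : k)⁻¹ * ∑ g : G, c j * (irrep j).character g *
      (irrep i).character g⁻¹ = if i = j then c j else 0 := by
    simp only [mul_assoc]
    rw [← Finset.mul_sum, mul_left_comm, card_inv_mul_sum_char_mul_char, finrank_hom_irrep]
    split_ifs <;> simp
  have h := congrArg (fun f : G → k => (Fintype.card G : k)⁻¹ *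
    ∑ g : G, f g * (irrep i).character g⁻¹) hc
  simp only [Finset.sum_apply, Pi.smul_apply, smul_eq_mul, Finset.sum_mul, Pi.zero_apply,
    zero_mul, Finset.sum_const_zero, mul_zero] at h
  rw [Finset.sum_comm, Finset.mul_sum] at h
  simpa [pairing, hi] using h

instance [Finite G] : Finite (Irr k G) := linearIndependent_char_irrep.finite

instance [Finite G] : Fintype (Irr k G) := Fintype.ofFinite _

lemma char_eq_sum [Finite G] (V : FDRep k G) (g : G) :
    V.character g =
      ∑ i : Irr k G, (Module.finrank k (irrep i ⟶ V) : k) * (irrep i).character g := by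
  classical
  induction V using rep_induction with
  | iso V W e ih =>
    rw [FDRep.char_iso e, ih]
    exact Finset.sum_congr rfl fun i _ => by rw [finrank_hom_congr_right _ e]
  | zero V hV =>
    rw [char_of_isZero hV]
    refine (Finset.sum_eq_zero fun i _ => ?_).symm
    have : Subsingleton (irrep i ⟶ V) := ⟨fun f g => hV.eq_of_tgt _ _⟩
    rw [Module.finrank_zero_of_subsingleton, Nat.cast_zero, zero_mul]
  | simple V hV =>
    obtain ⟨j, ⟨e⟩⟩ := exists_iso_irrep V
    simp [FDRep.char_iso e, finrank_hom_congr_right _ e, finrank_hom_irrep]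
  | biprod V W hV hW =>
    simp only [char_biprod, hV, hW, finrank_hom_biprod_right, Nat.cast_add, add_mul,
      Finset.sum_add_distrib]

end Irreducibles

section ColumnOrthogonality

variable (k : Type u) [Field k] {G : Type v} [Group G] [Fintype G] [DecidableEq G]

/-- The regular representation of `G`, on functions on `Fin (card G)` so that its underlying space
lies in the universe of `k`. -/
def regularRepresentation (G : Type v) [Group G] [Fintype G] :
    Representation k G (Fin (Fintype.card G) → k) where
  toFun g := LinearMap.funLeft k k fun i => Fintype.equivFin G ((Fintype.equivFin G).symm i * g)
  map_one' := by ext; simp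
  map_mul' g h := by
    ext
    simp [LinearMap.funLeft, mul_assoc]

lemma char_regularRepresentation (g : G) :
    (FDRep.of (regularRepresentation k G)).character g =
      if g = 1 then (Fintype.card G : k) else 0 := by
  have diag (i : Fin (Fintype.card G)) :
      regularRepresentation k G g (Pi.single i 1) i = if g = 1 then (1 : k) else 0 := by
    have : Fintype.equivFin G ((Fintype.equivFin G).symm i * g) = i ↔ g = 1 := by
      rw [← Equiv.eq_symm_apply, mul_eq_left]
    simp only [regularRepresentation, MonoidHom.coe_mk, OneHom.coe_mk, LinearMap.funLeft_apply,
      Pi.single_apply, this]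
  change LinearMap.trace k (Fin (Fintype.card G) → k) (regularRepresentation k G g) = _
  rw [LinearMap.trace_eq_matrix_trace k (Pi.basisFun k _), Matrix.trace]
  simp only [Matrix.diag, LinearMap.toMatrix_apply, Pi.basisFun_repr, Pi.basisFun_apply, diag]
  split_ifs <;> simp

variable [CharZero k] [IsAlgClosed k]

lemma sum_finrank_mul_char (g : G) :
    ∑ i : Irr k G, (Module.finrank k (irrep i) : k) * (irrep i).character g =
      if g = 1 then (Fintype.card G : k) else 0 := by
  rw [← char_regularRepresentation, char_eq_sum]
  refine Finset.sum_congr rfl fun i _ => ?_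
  rw [← card_inv_mul_sum_char_mul_char]
  simp [char_regularRepresentation]

lemma column_orthogonality (x y : G) :
    ∑ i : Irr k G, (irrep i).character x * (irrep i).character y⁻¹ =
      ∑ g : G, if g * y = x * g then 1 else 0 := by
  have hG : (Fintype.card G : k) ≠ 0 := by simp
  simp only [char_mul_char_inv]
  rw [← Finset.mul_sum, Finset.sum_comm]
  simp only [sum_finrank_mul_char, Finset.mul_sum, mul_ite, mul_zero, inv_mul_cancel₀ hG]
  refine Finset.sum_congr rfl fun g _ => if_congr ?_ rfl rfl
  rw [← mul_assoc, mul_inv_eq_one, ← mul_assoc, mul_inv_eq_iff_eq_mul, eq_comm]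

end ColumnOrthogonality

section Eigenvectors

variable {k : Type u} [Field k] {G : Type v} [Group G] {K : Type*} [Group K]
  (φ : K →* G) (χ : K →* k)

/-- The pullback of `V` along `φ`, twisted by the inverse of the character `χ`. -/
def twistedRestriction (V : FDRep k G) : Representation k K V where
  toFun x := χ x⁻¹ • V.ρ (φ x)
  map_one' := by simp
  map_mul' x y := by
    rw [map_mul, map_mul, smul_mul_smul_comm, mul_inv_rev, map_mul, mul_comm]

/-- The vectors on which `K` acts through the character `χ`. -/
def eigenvectors (V : FDRep k G) : Submodule k V := (twistedRestriction φ χ V).invariants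

variable {φ χ} in
lemma mem_eigenvectors {V : FDRep k G} {v : V} :
    v ∈ eigenvectors φ χ V ↔ ∀ x, V.ρ (φ x) v = χ x • v := by
  refine forall_congr' fun x => ?_
  have hχ : χ x⁻¹ * χ x = 1 := by rw [← map_mul, inv_mul_cancel, map_one]
  have hχ' : χ x * χ x⁻¹ = 1 := by rw [← map_mul, mul_inv_cancel, map_one]
  change χ x⁻¹ • V.ρ (φ x) v = v ↔ _
  refine ⟨fun h => ?_, fun h => ?_⟩
  · rw [← one_smul k (V.ρ (φ x) v), ← hχ', mul_smul, h]
  · rw [h, smul_smul, hχ, one_smul]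

/-- The multiplicity of the character `χ` in the pullback of `V` along `φ`. -/
def charMult (V : FDRep k G) : ℕ := Module.finrank k (eigenvectors φ χ V)

variable {φ χ} in
lemma charMult_pos_iff {V : FDRep k G} :
    0 < charMult φ χ V ↔ ∃ v ∈ eigenvectors φ χ V, v ≠ 0 := by
  rw [charMult, Module.finrank_pos_iff, Submodule.nontrivial_iff_ne_bot, Submodule.ne_bot_iff]

variable {φ χ} in
lemma charMult_tensor_pos {χ' : K →* k} {V W : FDRep k G} (hV : 0 < charMult φ χ V)
    (hW : 0 < charMult φ χ' W) : 0 < charMult φ (χ * χ') (V ⊗ W) := by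
  rw [charMult_pos_iff] at *
  obtain ⟨v, hv, hv0⟩ := hV
  obtain ⟨w, hw, hw0⟩ := hW
  refine ⟨(v ⊗ₜ[k] w : TensorProduct k V W), mem_eigenvectors.2 fun x => ?_, fun h => ?_⟩
  · change TensorProduct.map (V.ρ (φ x)) (W.ρ (φ x)) (v ⊗ₜ[k] w) = _
    rw [TensorProduct.map_tmul, mem_eigenvectors.1 hv, mem_eigenvectors.1 hw,
      TensorProduct.smul_tmul_smul]
    rfl
  · obtain ⟨f, hf⟩ := Module.Projective.exists_dual_eq_one k hv0
    obtain ⟨g, hg⟩ := Module.Projective.exists_dual_eq_one k hw0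
    have hfg := congrArg (LinearMap.mul' k k ∘ₗ TensorProduct.map f g) h
    rw [LinearMap.comp_apply, TensorProduct.map_tmul, LinearMap.mul'_apply, hf, hg, map_zero] at hfg
    exact one_ne_zero ((mul_one (1 : k)).symm.trans hfg)

variable [CharZero k]

lemma charMult_eq [Fintype K] (V : FDRep k G) :
    (charMult φ χ V : k) = (Fintype.card K : k)⁻¹ * ∑ x, χ x⁻¹ * V.character (φ x) := by
  have := invertibleOfNonzero (NeZero.ne (Nat.card K : k))
  rw [charMult, eigenvectors, ← Representation.card_inv_mul_sum_char_eq_finrank,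
    Nat.card_eq_fintype_card]
  refine congrArg _ (Finset.sum_congr rfl fun x _ => ?_)
  exact map_smul (LinearMap.trace k V) (χ x⁻¹) (V.ρ (φ x))

lemma charMult_eq_inv [Fintype K] (V : FDRep k G) :
    (charMult φ χ V : k) = (Fintype.card K : k)⁻¹ * ∑ x, χ x * V.character (φ x)⁻¹ := by
  rw [charMult_eq, ← Equiv.sum_comp (Equiv.inv K)]
  simp

lemma charMult_congr [Finite K] {V W : FDRep k G} (e : V ≅ W) :
    charMult φ χ V = charMult φ χ W := by
  have := Fintype.ofFinite K
  have h := charMult_eq φ χ V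
  rw [FDRep.char_iso e, ← charMult_eq] at h
  exact_mod_cast h

lemma charMult_eq_sum [IsAlgClosed k] [Finite K] [Finite G] (V : FDRep k G) :
    charMult φ χ V =
      ∑ i : Irr k G, Module.finrank k (irrep i ⟶ V) * charMult φ χ (irrep i) := by
  have := Fintype.ofFinite K
  have : (charMult φ χ V : k) =
      ∑ i : Irr k G, (Module.finrank k (irrep i ⟶ V) : k) * charMult φ χ (irrep i) := by
    simp only [charMult_eq, char_eq_sum V, Finset.mul_sum]
    rw [Finset.sum_comm]
    exact Finset.sum_congr rfl fun i _ => Finset.sum_congr rfl fun x _ => by ring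
  exact_mod_cast this

end Eigenvectors

section MackeyFormula

variable {k : Type u} [Field k] [CharZero k] [IsAlgClosed k]
  {G : Type v} [Group G] [Fintype G] [DecidableEq G] {K : Type*} [Group K] [Fintype K]
  (φ : K →* G) (χ : K →* k)

lemma sum_charMult_mul_charMult (χ' : K →* k) :
    ∑ i : Irr k G, (charMult φ χ (irrep i) : k) * charMult φ χ' (irrep i) =
      ((Fintype.card K : k) ^ 2)⁻¹ * ∑ g : G, ∑ x, ∑ y,
        if g * φ y = φ x * g then χ x⁻¹ * χ' y else 0 := by
  have expand (i : Irr k G) : (charMult φ χ (irrep i) : k) * charMult φ χ' (irrep i) =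
      ((Fintype.card K : k) ^ 2)⁻¹ * ∑ x, ∑ y, χ x⁻¹ * χ' y *
        ((irrep i).character (φ x) * (irrep i).character (φ y)⁻¹) := by
    rw [charMult_eq φ χ, charMult_eq_inv φ χ', mul_mul_mul_comm, Finset.sum_mul_sum, ← mul_inv,
      sq]
    simp only [mul_mul_mul_comm]
  simp only [expand]
  rw [← Finset.mul_sum, Finset.sum_comm, Finset.sum_comm (s := Finset.univ (α := G))]
  refine congrArg _ (Finset.sum_congr rfl fun x _ => ?_)
  rw [Finset.sum_comm, Finset.sum_comm (s := Finset.univ (α := G))]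
  refine Finset.sum_congr rfl fun y _ => ?_
  rw [← Finset.mul_sum, column_orthogonality, Finset.mul_sum]
  simp

variable {φ} in
omit [DecidableEq G] in
lemma sum_charMult_mul_finrank (hφ : Function.Injective φ) :
    ∑ i : Irr k G, (charMult φ χ (irrep i) : k) * Module.finrank k (irrep i) =
      (Fintype.card K : k)⁻¹ * Fintype.card G := by
  classical
  have expand (i : Irr k G) : (charMult φ χ (irrep i) : k) * Module.finrank k (irrep i) =
      (Fintype.card K : k)⁻¹ * ∑ x, χ x⁻¹ *
        ((Module.finrank k (irrep i) : k) * (irrep i).character (φ x)) := by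
    rw [charMult_eq φ χ, mul_assoc, Finset.sum_mul]
    exact congrArg _ (Finset.sum_congr rfl fun x _ => by ring)
  simp only [expand]
  rw [← Finset.mul_sum, Finset.sum_comm]
  simp only [← Finset.mul_sum, sum_finrank_mul_char, map_eq_one_iff φ hφ]
  simp

end MackeyFormula

section GelfandTrick

variable {k : Type u} [Field k] {G : Type v} [Group G] {K : Type*} [Group K] [Fintype K]
  (φ : K →* G) (χ : K →* k) (V : FDRep k G)

/-- The averaging projector onto the `χ`-eigenvectors of `K`. -/
def eigenProj : Module.End k V :=
  (Fintype.card K : k)⁻¹ • ∑ x, χ x⁻¹ • V.ρ (φ x)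

/-- The compression of `ρ(g)` to the `χ`-eigenvectors of `K`; these operators generate the Hecke
algebra of `(G, K, χ)` acting on `V`. -/
def heckeOp (g : G) : Module.End k V := eigenProj φ χ V * V.ρ g * eigenProj φ χ V

lemma rho_mul_eigenProj (x : K) : V.ρ (φ x) * eigenProj φ χ V = χ x • eigenProj φ χ V := by
  have hχ : χ x * χ x⁻¹ = 1 := by rw [← map_mul, mul_inv_cancel, map_one]
  rw [eigenProj, mul_smul_comm, smul_comm (χ x), Finset.mul_sum, Finset.smul_sum (r := χ x)]
  refine congrArg _ (Fintype.sum_equiv (Equiv.mulLeft x) _ _ fun y => ?_)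
  rw [Equiv.coe_mulLeft, mul_smul_comm, smul_smul, ← map_mul, ← map_mul, mul_inv_rev,
    map_mul χ, mul_left_comm, hχ, mul_one]

lemma eigenProj_mul_rho (x : K) : eigenProj φ χ V * V.ρ (φ x) = χ x • eigenProj φ χ V := by
  have hχ : χ x * χ x⁻¹ = 1 := by rw [← map_mul, mul_inv_cancel, map_one]
  rw [eigenProj, smul_mul_assoc, smul_comm (χ x), Finset.sum_mul, Finset.smul_sum (r := χ x)]
  refine congrArg _ (Fintype.sum_equiv (Equiv.mulRight x) _ _ fun y => ?_)
  rw [Equiv.coe_mulRight, smul_mul_assoc, smul_smul, ← map_mul, ← map_mul, mul_inv_rev,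
    map_mul χ, ← mul_assoc, hχ, one_mul]

lemma heckeOp_map_mul_mul_map (g : G) (x y : K) :
    heckeOp φ χ V (φ x * g * φ y) = (χ x * χ y) • heckeOp φ χ V g := by
  rw [heckeOp, map_mul, map_mul, mul_assoc _ _ (eigenProj φ χ V),
    mul_assoc _ _ (eigenProj φ χ V), rho_mul_eigenProj, ← mul_assoc, ← mul_assoc,
    eigenProj_mul_rho, mul_smul_comm, smul_mul_assoc, smul_mul_assoc, smul_smul, mul_comm (χ x)]
  rfl

variable [CharZero k]

variable {φ χ V} in
lemma eigenProj_apply_of_mem {v : V} (hv : v ∈ eigenvectors φ χ V) : eigenProj φ χ V v = v := by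
  have hχ (x : K) : χ x⁻¹ * χ x = 1 := by rw [← map_mul, inv_mul_cancel, map_one]
  simp only [eigenProj, LinearMap.smul_apply, LinearMap.sum_apply, mem_eigenvectors.1 hv,
    smul_smul, hχ, one_smul, Finset.sum_const, Finset.card_univ]
  rw [← Nat.cast_smul_eq_nsmul k, smul_smul, inv_mul_cancel₀ (by simp), one_smul]

lemma eigenProj_mul_self : eigenProj φ χ V * eigenProj φ χ V = eigenProj φ χ V :=
  LinearMap.ext fun v => eigenProj_apply_of_mem <| mem_eigenvectors.2 fun x =>
    LinearMap.congr_fun (rho_mul_eigenProj φ χ V x) v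

lemma heckeOp_mul_heckeOp (g h : G) : heckeOp φ χ V g * heckeOp φ χ V h =
    (Fintype.card K : k)⁻¹ • ∑ x, χ x⁻¹ • heckeOp φ χ V (g * φ x * h) := by
  calc heckeOp φ χ V g * heckeOp φ χ V h
      = eigenProj φ χ V * V.ρ g * eigenProj φ χ V * V.ρ h * eigenProj φ χ V := by
        simp only [heckeOp, mul_assoc]
        rw [← mul_assoc (eigenProj φ χ V) (eigenProj φ χ V), eigenProj_mul_self]
    _ = _ := by
        conv_lhs => enter [1, 1, 2]; rw [eigenProj]
        simp only [mul_smul_comm, smul_mul_assoc, Finset.mul_sum, Finset.sum_mul, heckeOp, map_mul,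
          mul_assoc]

lemma heckeOp_comm {τ : G → G} (τ_mul : ∀ g h, τ (g * h) = τ h * τ g)
    (τ_map : ∀ x, τ (φ x) = φ x) (heckeOp_τ : ∀ g, heckeOp φ χ V (τ g) = heckeOp φ χ V g)
    (g h : G) : heckeOp φ χ V g * heckeOp φ χ V h = heckeOp φ χ V h * heckeOp φ χ V g := by
  have flip (x : K) : heckeOp φ χ V (g * φ x * h) = heckeOp φ χ V (τ h * φ x * τ g) := by
    rw [← heckeOp_τ, τ_mul, τ_mul, τ_map, mul_assoc]
  simp only [heckeOp_mul_heckeOp φ χ V g, flip]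
  rw [← heckeOp_mul_heckeOp, heckeOp_τ, heckeOp_τ]

lemma sum_dual_apply_rho_smul [IsAlgClosed k] [Fintype G] [Simple V] (m : Module.Dual k V)
    (v w : V) : ∑ g : G, m (V.ρ g⁻¹ w) • V.ρ g v =
      ((Fintype.card G : k) * m v / Module.finrank k V) • w := by
  have h := LinearMap.congr_fun (sum_conj_eq_smul_one V (m.smulRight v)) w
  rw [LinearMap.trace_smulRight] at h
  simpa [Module.End.mul_apply] using h

/-- Compressing the operators `∑ g, m (ρ(g⁻¹) w) ρ(g)` for `w` in the eigenspace gives commuting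
operators which send a vector `v` with `m v = 1` to a multiple of any given `w`. -/
lemma charMult_le_one [IsAlgClosed k] [Finite G] [Simple V] {τ : G → G}
    (τ_mul : ∀ g h, τ (g * h) = τ h * τ g)
    (τ_map : ∀ x, τ (φ x) = φ x) (heckeOp_τ : ∀ g, heckeOp φ χ V (τ g) = heckeOp φ χ V g) :
    charMult φ χ V ≤ 1 := by
  have := Fintype.ofFinite G
  rcases Nat.eq_zero_or_pos (charMult φ χ V) with h0 | hpos
  · exact h0.le.trans zero_le_one
  obtain ⟨v, hv, hv0⟩ := charMult_pos_iff.1 hpos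
  obtain ⟨m, hm⟩ := Module.Projective.exists_dual_eq_one k hv0
  set c : k := Fintype.card G / Module.finrank k V with hc
  have hc0 : c ≠ 0 := div_ne_zero (by simp) (by exact_mod_cast (finrank_pos_of_simple V).ne')
  let T (w : V) : Module.End k V := ∑ g : G, m (V.ρ g⁻¹ w) • heckeOp φ χ V g
  have T_apply {w x : V} (hw : w ∈ eigenvectors φ χ V) (hx : x ∈ eigenvectors φ χ V) :
      T w x = (c * m x) • w := by
    calc T w x = eigenProj φ χ V (∑ g : G, m (V.ρ g⁻¹ w) • V.ρ g x) := by
          simp only [T, heckeOp, LinearMap.sum_apply, LinearMap.smul_apply, Module.End.mul_apply,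
            eigenProj_apply_of_mem hx, map_sum, map_smul]
      _ = _ := by
          rw [sum_dual_apply_rho_smul, map_smul, eigenProj_apply_of_mem hw, hc, div_mul_eq_mul_div]
  have T_comm (w x : V) : T w * T x = T x * T w := by
    simp only [T, Finset.sum_mul_sum, smul_mul_smul_comm]
    rw [Finset.sum_comm]
    refine Finset.sum_congr rfl fun g _ => Finset.sum_congr rfl fun h _ => ?_
    rw [heckeOp_comm φ χ V τ_mul τ_map heckeOp_τ, mul_comm (m _)]
  refine finrank_le_one ⟨v, hv⟩ fun ⟨w, hw⟩ => ⟨m w, Subtype.ext ?_⟩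
  have h := LinearMap.congr_fun (T_comm v w) v
  rw [Module.End.mul_apply, Module.End.mul_apply, T_apply hw hv, T_apply hv hv, map_smul, map_smul,
    T_apply hv hw, T_apply hw hv, hm, smul_smul, smul_smul, mul_one] at h
  refine smul_right_injective V (mul_ne_zero hc0 hc0) ?_
  exact (smul_smul _ _ _).trans <| (congrArg (· • v) (mul_assoc _ _ _)).trans h

end GelfandTrick

section RepresentationRing

variable {G : Type u} [Group G]

/-- The character of an isomorphism class of representations. -/
def skeletonChar (G : Type u) [Group G] : Skeleton (FDRep ℂ G) →* (G → ℂ) where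
  toFun s := ((fromSkeleton (FDRep ℂ G)).obj s).character
  map_one' := by
    rw [Skeleton.one_eq, FDRep.char_iso (fromSkeletonToSkeletonIso (𝟙_ (FDRep ℂ G)))]
    ext g
    exact (LinearMap.trace_id ℂ ℂ).trans (by simp)
  map_mul' s t := by
    rw [← toSkeleton_fromSkeleton_obj s, ← toSkeleton_fromSkeleton_obj t,
      ← Skeleton.toSkeleton_tensorObj, FDRep.char_iso (fromSkeletonToSkeletonIso _),
      FDRep.char_tensor, FDRep.char_iso (fromSkeletonToSkeletonIso _),
      FDRep.char_iso (fromSkeletonToSkeletonIso _)]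

/-- The ring homomorphism extending `skeletonChar` linearly to formal combinations of
isomorphism classes. -/
def freeChar (G : Type u) [Group G] : FreeRepRing G →+* (G → ℂ) :=
  (MonoidAlgebra.lift ℤ (G → ℂ) (Skeleton (FDRep ℂ G)) (skeletonChar G)).toRingHom

lemma freeChar_freeClass (V : FDRep ℂ G) : freeChar G (freeClass V) = V.character :=
  (MonoidAlgebra.lift_of (skeletonChar G) (toSkeleton V)).trans
    (FDRep.char_iso (fromSkeletonToSkeletonIso V))

/-- The character homomorphism on the representation ring. -/
def repRingChar (G : Type u) [Group G] : RepRing G →+* (G → ℂ) :=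
  Ideal.Quotient.lift (directSumIdeal G) (freeChar G) fun a ha => by
    suffices h : directSumIdeal G ≤ RingHom.ker (freeChar G) from RingHom.mem_ker.1 (h ha)
    refine Ideal.span_le.2 ?_
    rintro _ ⟨V, W, rfl⟩
    rw [SetLike.mem_coe, RingHom.mem_ker, map_sub, map_add, freeChar_freeClass,
      freeChar_freeClass, freeChar_freeClass, sub_eq_zero]
    exact funext (char_biprod V W)

lemma repRingChar_repClass (V : FDRep ℂ G) : repRingChar G (repClass V) = V.character :=
  (Ideal.Quotient.lift_mk _ _ _).trans (freeChar_freeClass V)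

lemma repClass_iso {V W : FDRep ℂ G} (e : V ≅ W) : repClass V = repClass W := by
  rw [repClass, repClass, freeClass, freeClass, congr_toSkeleton_of_iso e]

lemma repClass_biprod (V W : FDRep ℂ G) : repClass (V ⊞ W) = repClass V + repClass W := by
  rw [repClass, repClass, repClass, ← map_add, Ideal.Quotient.eq]
  exact Ideal.subset_span ⟨V, W, rfl⟩

lemma repClass_zero {V : FDRep ℂ G} (h : IsZero V) : repClass V = 0 := by
  have hadd := repClass_biprod V V
  rw [repClass_iso (((biprod_isZero_iff V V).2 ⟨h, h⟩).iso h)] at hadd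
  exact left_eq_add.1 hadd

lemma closure_repClass_eq_top [Finite G] :
    AddSubgroup.closure {x : RepRing G | ∃ V : FDRep ℂ G, Simple V ∧ x = repClass V} = ⊤ := by
  set S := AddSubgroup.closure {x : RepRing G | ∃ V : FDRep ℂ G, Simple V ∧ x = repClass V}
  have repClass_mem (V : FDRep ℂ G) : repClass V ∈ S := by
    induction V using rep_induction with
    | iso V W e ih => rwa [repClass_iso e]
    | zero V hV => rw [repClass_zero hV]; exact S.zero_mem
    | simple V hV => exact AddSubgroup.subset_closure ⟨V, hV, rfl⟩
    | biprod V W hV hW => rw [repClass_biprod]; exact S.add_mem hV hW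
  rw [eq_top_iff]
  rintro x -
  obtain ⟨y, rfl⟩ := Ideal.Quotient.mk_surjective x
  induction y using MonoidAlgebra.induction_on with
  | of s =>
    have hs := repClass_mem ((fromSkeleton _).obj s)
    rwa [repClass, freeClass, toSkeleton_fromSkeleton_obj] at hs
  | add a b ha hb => rw [map_add]; exact S.add_mem ha hb
  | smul r a ha => rw [map_zsmul]; exact S.zsmul_mem ha r

/-- The additive functional on the representation ring pairing a class with the character of
`V`. -/
def pairing [Fintype G] (V : FDRep ℂ G) : RepRing G →+ ℂ where
  toFun x := (Fintype.card G : ℂ)⁻¹ * ∑ g : G, repRingChar G x g * V.character g⁻¹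
  map_zero' := by simp
  map_add' x y := by
    simp only [map_add, Pi.add_apply, add_mul, Finset.sum_add_distrib, mul_add]

lemma pairing_repClass [Fintype G] (V W : FDRep ℂ G) :
    pairing V (repClass W) = Module.finrank ℂ (V ⟶ W) := by
  change (Fintype.card G : ℂ)⁻¹ * ∑ g : G, repRingChar G (repClass W) g * V.character g⁻¹ = _
  rw [repRingChar_repClass, card_inv_mul_sum_char_mul_char]

lemma exists_iso_of_repClass_mem_closure [Finite G] {P : FDRep ℂ G → Prop}
    (hP : ∀ W, P W → Simple W) {V : FDRep ℂ G} [Simple V]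
    (h : repClass V ∈ AddSubgroup.closure {x | ∃ W, P W ∧ x = repClass W}) :
    ∃ W, P W ∧ Nonempty (V ≅ W) := by
  classical
  have := Fintype.ofFinite G
  by_contra! not_iso
  have closure_le : AddSubgroup.closure {x | ∃ W, P W ∧ x = repClass W} ≤ (pairing V).ker := by
    rw [AddSubgroup.closure_le]
    rintro _ ⟨W, hW, rfl⟩
    have := hP W hW
    rw [SetLike.mem_coe, AddMonoidHom.mem_ker, pairing_repClass,
      FDRep.finrank_hom_simple_simple, if_neg (not_nonempty_iff.2 (not_iso W hW)), Nat.cast_zero]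
  have pairing_self := closure_le h
  rw [AddMonoidHom.mem_ker, pairing_repClass, FDRep.finrank_hom_simple_simple,
    if_pos ⟨Iso.refl V⟩, Nat.cast_one] at pairing_self
  exact one_ne_zero pairing_self

end RepresentationRing

section BruhatDecomposition

variable {F : Type u} [Field F]

/-- The embedding of the additive group of `F` as the upper unitriangular matrices. -/
def unip : Multiplicative F →* SL2 F where
  toFun x := ⟨!![1, x.toAdd; 0, 1], by simp [Matrix.det_fin_two]⟩
  map_one' := by ext i j; fin_cases i <;> fin_cases j <;> simp
  map_mul' x y := by
    apply Subtype.ext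
    change _ = !![1, x.toAdd; 0, 1] * !![1, y.toAdd; 0, 1]
    simp [add_comm]

/-- The upper triangular matrix with diagonal `t, t⁻¹` and upper right entry `x`. -/
def upper (t : Fˣ) (x : F) : SL2 F :=
  ⟨!![(t : F), x; 0, ((t⁻¹ : Fˣ) : F)], by simp [Matrix.det_fin_two]⟩

/-- The element of the big Bruhat cell with diagonal `a, d` and lower left entry `c`. -/
def bigCell (c : Fˣ) (a d : F) : SL2 F :=
  ⟨!![a, (a * d - 1) * ((c⁻¹ : Fˣ) : F); (c : F), d], by simp [Matrix.det_fin_two]⟩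

@[simp] lemma unip_apply_00 (x : Multiplicative F) : (unip x).1 0 0 = 1 := rfl
@[simp] lemma unip_apply_01 (x : Multiplicative F) : (unip x).1 0 1 = x.toAdd := rfl
@[simp] lemma unip_apply_10 (x : Multiplicative F) : (unip x).1 1 0 = 0 := rfl
@[simp] lemma unip_apply_11 (x : Multiplicative F) : (unip x).1 1 1 = 1 := rfl
@[simp] lemma upper_apply_00 (t : Fˣ) (x : F) : (upper t x).1 0 0 = (t : F) := rfl
@[simp] lemma upper_apply_01 (t : Fˣ) (x : F) : (upper t x).1 0 1 = x := rfl
@[simp] lemma upper_apply_10 (t : Fˣ) (x : F) : (upper t x).1 1 0 = 0 := rfl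
@[simp] lemma upper_apply_11 (t : Fˣ) (x : F) : (upper t x).1 1 1 = ((t⁻¹ : Fˣ) : F) := rfl
@[simp] lemma bigCell_apply_00 (c : Fˣ) (a d : F) : (bigCell c a d).1 0 0 = a := rfl
@[simp] lemma bigCell_apply_01 (c : Fˣ) (a d : F) :
    (bigCell c a d).1 0 1 = (a * d - 1) * ((c⁻¹ : Fˣ) : F) := rfl
@[simp] lemma bigCell_apply_10 (c : Fˣ) (a d : F) : (bigCell c a d).1 1 0 = (c : F) := rfl
@[simp] lemma bigCell_apply_11 (c : Fˣ) (a d : F) : (bigCell c a d).1 1 1 = d := rfl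

lemma SL2_ext_iff {g h : SL2 F} : g = h ↔ g.1 0 0 = h.1 0 0 ∧ g.1 0 1 = h.1 0 1 ∧
    g.1 1 0 = h.1 1 0 ∧ g.1 1 1 = h.1 1 1 := by
  constructor
  · rintro rfl; simp
  · rintro ⟨h00, h01, h10, h11⟩
    apply Subtype.ext
    ext i j; fin_cases i <;> fin_cases j <;> assumption

lemma SL2_mul_apply (g h : SL2 F) (i j : Fin 2) :
    (g * h).1 i j = g.1 i 0 * h.1 0 j + g.1 i 1 * h.1 1 j := by
  change (g.1 * h.1) i j = _
  rw [Matrix.mul_apply, Fin.sum_univ_two]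

lemma SL2_det (g : SL2 F) : g.1 0 0 * g.1 1 1 - g.1 0 1 * g.1 1 0 = 1 := by
  rw [← Matrix.det_fin_two]; exact g.2

lemma exists_eq_upper {g : SL2 F} (hg : g.1 1 0 = 0) : ∃ t x, g = upper t x := by
  have hdet := SL2_det g
  rw [hg, mul_zero, sub_zero] at hdet
  exact ⟨Units.mkOfMulEqOne _ _ hdet, g.1 0 1, SL2_ext_iff.2 ⟨rfl, rfl, hg, rfl⟩⟩

lemma exists_eq_bigCell {g : SL2 F} (hg : g.1 1 0 ≠ 0) : ∃ c a d, g = bigCell c a d := by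
  refine ⟨Units.mk0 _ hg, g.1 0 0, g.1 1 1, SL2_ext_iff.2 ⟨rfl, ?_, rfl, rfl⟩⟩
  have hdet := SL2_det g
  simp only [bigCell_apply_01, Units.val_inv_eq_inv_val, Units.val_mk0]
  field_simp
  linear_combination -hdet

/-- The Bruhat decomposition of `SL₂`, sending `(t, x)` to `upper t x` and `(c, a, d)` to
`bigCell c a d`. -/
def bruhatMap : (Fˣ × F) ⊕ (Fˣ × F × F) → SL2 F :=
  Sum.elim (fun p => upper p.1 p.2) (fun p => bigCell p.1 p.2.1 p.2.2)

lemma bruhatMap_bijective : Function.Bijective (bruhatMap (F := F)) := by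
  constructor
  · rintro (⟨t, x⟩ | ⟨c, a, d⟩) (⟨t', x'⟩ | ⟨c', a', d'⟩) h <;>
      simp only [bruhatMap, Sum.elim_inl, Sum.elim_inr] at h <;> rw [SL2_ext_iff] at h
    · simp only [upper_apply_00, upper_apply_01, Units.val_inj] at h
      rw [h.1, h.2.1]
    · exact absurd h.2.2.1.symm c'.ne_zero
    · exact absurd h.2.2.1 c.ne_zero
    · simp only [bigCell_apply_00, bigCell_apply_10, bigCell_apply_11, Units.val_inj] at h
      rw [h.1, h.2.2.1, h.2.2.2]
  · intro g
    by_cases hg : g.1 1 0 = 0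
    · obtain ⟨t, x, rfl⟩ := exists_eq_upper hg
      exact ⟨.inl (t, x), rfl⟩
    · obtain ⟨c, a, d, rfl⟩ := exists_eq_bigCell hg
      exact ⟨.inr (c, a, d), rfl⟩

lemma sum_bruhat [Fintype F] [DecidableEq F] {M : Type*} [AddCommMonoid M] (f : SL2 F → M) :
    ∑ g, f g = ∑ t : Fˣ, ∑ x : F, f (upper t x) +
      ∑ c : Fˣ, ∑ a : F, ∑ d : F, f (bigCell c a d) := by
  rw [← Equiv.sum_comp (Equiv.ofBijective _ bruhatMap_bijective), Fintype.sum_sum_type]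
  simp [Fintype.sum_prod_type, bruhatMap]

lemma card_units_eq_sub_one [Fintype F] [DecidableEq F] :
    (Fintype.card Fˣ : ℂ) = Fintype.card F - 1 := by
  rw [Fintype.card_units, Nat.cast_sub Fintype.card_pos, Nat.cast_one]

lemma card_SL2 [Fintype F] [DecidableEq F] : (Fintype.card (SL2 F) : ℂ) =
    Fintype.card F * (Fintype.card F - 1) * (Fintype.card F + 1) := by
  have h := sum_bruhat (F := F) (fun _ => (1 : ℂ))
  simp only [Finset.sum_const, Finset.card_univ, nsmul_eq_mul, mul_one, card_units_eq_sub_one] at h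
  rw [h]
  ring

/-- The upper triangular matrices. -/
def borel (F : Type u) [Field F] : Subgroup (SL2 F) where
  carrier := {g | g.1 1 0 = 0}
  one_mem' := by simp
  mul_mem' {g h} hg hh := by
    simp only [Set.mem_ofPred_eq] at *
    rw [SL2_mul_apply, hg, hh, zero_mul, mul_zero, add_zero]
  inv_mem' {g} hg := by
    simp only [Set.mem_ofPred_eq] at *
    simp [Matrix.SpecialLinearGroup.coe_inv, Matrix.adjugate_fin_two, hg]

lemma borel_det (g : borel F) : g.1.1 0 0 * g.1.1 1 1 = 1 := by
  have hdet := SL2_det g.1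
  rwa [show g.1.1 1 0 = 0 from g.2, mul_zero, sub_zero] at hdet

/-- The upper left entry of an upper triangular matrix. -/
def borelDiag : borel F →* Fˣ where
  toFun g := Units.mkOfMulEqOne _ _ (borel_det g)
  map_one' := by ext; simp
  map_mul' g h := by
    ext
    change (g.1 * h.1).1 0 0 = g.1.1 0 0 * h.1.1 0 0
    rw [SL2_mul_apply, show h.1.1 1 0 = 0 from h.2, mul_zero, add_zero]

/-- The parametrisation of the upper triangular matrices by the torus and the unipotent part. -/
def borelEquiv : Fˣ × F ≃ borel F where
  toFun p := ⟨upper p.1 p.2, upper_apply_10 _ _⟩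
  invFun g := (borelDiag g, g.1.1 0 1)
  left_inv _ := Prod.ext (Units.ext rfl) rfl
  right_inv g := Subtype.ext (SL2_ext_iff.2 ⟨rfl, rfl, g.2.symm, rfl⟩)

instance [Fintype F] [DecidableEq F] : Fintype (borel F) := Fintype.ofEquiv _ borelEquiv

lemma borelDiag_borelEquiv (t : Fˣ) (x : F) : borelDiag (borelEquiv (t, x)) = t :=
  Units.ext rfl

lemma borel_subtype_borelEquiv (t : Fˣ) (x : F) :
    (borel F).subtype (borelEquiv (t, x)) = upper t x := rfl

lemma card_borel [Fintype F] [DecidableEq F] : (Fintype.card (borel F) : ℂ) =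
    Fintype.card F * (Fintype.card F - 1) := by
  rw [← Fintype.card_congr borelEquiv, Fintype.card_prod, Nat.cast_mul, card_units_eq_sub_one,
    mul_comm]

lemma sum_borel [Fintype F] [DecidableEq F] {M : Type*} [AddCommMonoid M] (f : borel F → M) :
    ∑ g, f g = ∑ t : Fˣ, ∑ x : F, f (borelEquiv (t, x)) := by
  rw [← Equiv.sum_comp borelEquiv, Fintype.sum_prod_type]

lemma upper_mul_unip_iff (t : Fˣ) (z x y : F) :
    upper t z * unip (.ofAdd y) = unip (.ofAdd x) * upper t z ↔ x = t ^ 2 * y := by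
  have ht : (t : F) ≠ 0 := t.ne_zero
  simp only [SL2_ext_iff, SL2_mul_apply, upper_apply_00, upper_apply_01, upper_apply_10,
    upper_apply_11, unip_apply_00, unip_apply_01, unip_apply_10, unip_apply_11, toAdd_ofAdd,
    Units.val_inv_eq_inv_val]
  constructor
  · rintro ⟨-, h01, -, -⟩
    field_simp at h01
    linear_combination -h01
  · rintro rfl
    refine ⟨by ring, by field_simp; ring, by ring, by ring⟩

lemma bigCell_mul_unip_iff (c : Fˣ) (a d x y : F) :
    bigCell c a d * unip (.ofAdd y) = unip (.ofAdd x) * bigCell c a d ↔ x = 0 ∧ y = 0 := by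
  have hc : (c : F) ≠ 0 := c.ne_zero
  simp only [SL2_ext_iff, SL2_mul_apply, bigCell_apply_00, bigCell_apply_01, bigCell_apply_10,
    bigCell_apply_11, unip_apply_00, unip_apply_01, unip_apply_10, unip_apply_11, toAdd_ofAdd,
    Units.val_inv_eq_inv_val]
  constructor
  · rintro ⟨h00, -, -, h11⟩
    exact ⟨(mul_eq_zero_iff_right hc).1 (by linear_combination -h00),
      (mul_eq_zero_iff_left hc).1 (by linear_combination h11)⟩
  · rintro ⟨rfl, rfl⟩
    refine ⟨by ring, by ring, by ring, by ring⟩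

lemma upper_mul_upper_iff (r s t : Fˣ) (z x y : F) :
    upper r z * upper s y = upper t x * upper r z ↔
      s = t ∧ x = r * (r * y + z * (s : F)⁻¹ - t * z) := by
  have hr : (r : F) ≠ 0 := r.ne_zero
  have hs : (s : F) ≠ 0 := s.ne_zero
  simp only [SL2_ext_iff, SL2_mul_apply, upper_apply_00, upper_apply_01, upper_apply_10,
    upper_apply_11, Units.val_inv_eq_inv_val]
  constructor
  · rintro ⟨h00, h01, -, -⟩
    refine ⟨Units.ext (mul_left_cancel₀ hr (by linear_combination h00)), ?_⟩
    field_simp at h01 ⊢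
    linear_combination -h01
  · rintro ⟨rfl, rfl⟩
    refine ⟨by ring, by field_simp; ring, by ring, by ring⟩

lemma bigCell_mul_upper_iff (c s t : Fˣ) (a d x y : F) :
    bigCell c a d * upper s y = upper t x * bigCell c a d ↔
      s = t⁻¹ ∧ x = a * ((t : F)⁻¹ - t) * (c : F)⁻¹ ∧ y = d * ((t : F)⁻¹ - t) * (c : F)⁻¹ := by
  have hc : (c : F) ≠ 0 := c.ne_zero
  have hs : (s : F) ≠ 0 := s.ne_zero
  have ht : (t : F) ≠ 0 := t.ne_zero
  simp only [SL2_ext_iff, SL2_mul_apply, bigCell_apply_00, bigCell_apply_01, bigCell_apply_10,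
    bigCell_apply_11, upper_apply_00, upper_apply_01, upper_apply_10,
    upper_apply_11, Units.val_inv_eq_inv_val]
  constructor
  · rintro ⟨h00, -, h10, h11⟩
    obtain rfl : s = t⁻¹ := Units.ext <| by
      rw [Units.val_inv_eq_inv_val]
      exact mul_left_cancel₀ hc (by linear_combination h10)
    simp only [Units.val_inv_eq_inv_val, inv_inv] at h00 h11
    refine ⟨rfl, ?_, ?_⟩
    · rw [eq_mul_inv_iff_mul_eq₀ hc]; linear_combination -h00
    · rw [eq_mul_inv_iff_mul_eq₀ hc]; linear_combination h11
  · rintro ⟨rfl, rfl, rfl⟩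
    simp only [Units.val_inv_eq_inv_val, inv_inv]
    refine ⟨by field_simp; ring, by field_simp; ring, by field_simp; ring, by field_simp; ring⟩

end BruhatDecomposition

section Multiplicities

variable {F : Type u} [Field F]

/-- The multiplicity of the unipotent character `x ↦ ψ (a * x)` in `V`. -/
def unipMult (ψ : AddChar F ℂ) (a : F) (V : FDRep ℂ (SL2 F)) : ℕ :=
  charMult unip (AddChar.mulShift ψ a).toMonoidHom V

/-- The multiplicity in `V` of a character of the diagonal torus, inflated to `borel F`. -/
def borelMult (χ : Fˣ →* ℂ) (V : FDRep ℂ (SL2 F)) : ℕ :=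
  charMult (borel F).subtype (χ.comp borelDiag) V

lemma unipMult_congr [Finite F] {V W : FDRep ℂ (SL2 F)} (e : V ≅ W) (ψ : AddChar F ℂ) (a : F) :
    unipMult ψ a V = unipMult ψ a W := charMult_congr _ _ e

lemma borelMult_congr [Finite F] {V W : FDRep ℂ (SL2 F)} (e : V ≅ W) (χ : Fˣ →* ℂ) :
    borelMult χ V = borelMult χ W := charMult_congr _ _ e

lemma borelMult_tensor_pos {χ χ' : Fˣ →* ℂ} {V W : FDRep ℂ (SL2 F)} (hV : 0 < borelMult χ V)
    (hW : 0 < borelMult χ' W) : 0 < borelMult (χ * χ') (V ⊗ W) := by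
  rw [borelMult, MonoidHom.mul_comp]
  exact charMult_tensor_pos hV hW

lemma unipMult_eq_sum [Finite F] (ψ : AddChar F ℂ) (a : F) (V : FDRep ℂ (SL2 F)) :
    unipMult ψ a V =
      ∑ i : Irr ℂ (SL2 F), Module.finrank ℂ (irrep i ⟶ V) * unipMult ψ a (irrep i) :=
  charMult_eq_sum _ _ V

lemma borelMult_eq_sum [Finite F] (χ : Fˣ →* ℂ) (V : FDRep ℂ (SL2 F)) : borelMult χ V =
    ∑ i : Irr ℂ (SL2 F), Module.finrank ℂ (irrep i ⟶ V) * borelMult χ (irrep i) :=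
  charMult_eq_sum _ _ V

variable [Fintype F]

lemma unipMult_eq (ψ : AddChar F ℂ) (a : F) (V : FDRep ℂ (SL2 F)) :
    (unipMult ψ a V : ℂ) =
      (Fintype.card F : ℂ)⁻¹ * ∑ x : F, ψ (-(a * x)) * V.character (unip (.ofAdd x)) := by
  rw [unipMult, charMult_eq, Fintype.card_multiplicative, ← Equiv.sum_comp Multiplicative.ofAdd]
  refine congrArg _ (Finset.sum_congr rfl fun x _ => ?_)
  rw [← mul_neg]
  rfl

lemma card_sub_one_ne_zero : (Fintype.card F : ℂ) - 1 ≠ 0 := by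
  classical
  rw [← card_units_eq_sub_one]
  simp

variable [DecidableEq F]

lemma borelMult_eq (χ : Fˣ →* ℂ) (V : FDRep ℂ (SL2 F)) :
    (borelMult χ V : ℂ) = ((Fintype.card F : ℂ) * (Fintype.card F - 1))⁻¹ *
      ∑ t : Fˣ, ∑ x : F, χ t⁻¹ * V.character (upper t x) := by
  rw [borelMult, charMult_eq, card_borel, sum_borel]
  refine congrArg _ (Finset.sum_congr rfl fun t _ => Finset.sum_congr rfl fun x _ => ?_)
  rw [borel_subtype_borelEquiv, MonoidHom.comp_apply, map_inv, borelDiag_borelEquiv]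

end Multiplicities

section MackeySums

variable {F : Type u} [Field F] [Fintype F]

lemma sum_unipMult_mul_eq_sum_commuting [DecidableEq F] (ψ : AddChar F ℂ) (a b : F) :
    ∑ i : Irr ℂ (SL2 F), (unipMult ψ a (irrep i) : ℂ) * unipMult ψ b (irrep i) =
      ((Fintype.card F : ℂ) ^ 2)⁻¹ * ∑ g : SL2 F, ∑ x : F, ∑ y : F,
        if g * unip (.ofAdd y) = unip (.ofAdd x) * g then ψ (-(a * x)) * ψ (b * y) else 0 := by
  simp only [unipMult]
  rw [sum_charMult_mul_charMult, Fintype.card_multiplicative]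
  simp only [← Equiv.sum_comp (Multiplicative.ofAdd (α := F)), ← mul_neg]
  rfl

lemma sum_upper_unip {ψ : AddChar F ℂ} [DecidableEq F] (hψ : ψ.IsPrimitive) (a b : F) (t : Fˣ) :
    ∑ x : F, ∑ y : F, (if x = t ^ 2 * y then ψ (-(a * x)) * ψ (b * y) else 0) =
      if a * t ^ 2 = b then (Fintype.card F : ℂ) else 0 := by
  have inner (y : F) : ∑ x : F, (if x = t ^ 2 * y then ψ (-(a * x)) * ψ (b * y) else 0) =
      ψ (y * (b - a * t ^ 2)) := by
    rw [Finset.sum_ite_eq' Finset.univ, if_pos (Finset.mem_univ _), ← AddChar.map_add_eq_mul]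
    exact congrArg ψ (by ring)
  rw [Finset.sum_comm]
  simp only [inner]
  rw [AddChar.sum_mulShift _ hψ, Nat.cast_ite, Nat.cast_zero]
  simp only [sub_eq_zero, eq_comm (a := b)]

lemma sum_bigCell_unip [DecidableEq F] (ψ : AddChar F ℂ) (a b : F) :
    ∑ x : F, ∑ y : F, (if x = 0 ∧ y = 0 then ψ (-(a * x)) * ψ (b * y) else 0) = 1 := by
  simp [ite_and]

lemma sum_unipMult_mul [DecidableEq F] {ψ : AddChar F ℂ} (hψ : ψ.IsPrimitive) (a b : F) :
    ∑ i : Irr ℂ (SL2 F), (unipMult ψ a (irrep i) : ℂ) * unipMult ψ b (irrep i) =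
      (Fintype.card F - 1) + ∑ t : Fˣ, if a * t ^ 2 = b then (1 : ℂ) else 0 := by
  have hq : (Fintype.card F : ℂ) ≠ 0 := by simp
  have count : (∑ t : Fˣ, if a * t ^ 2 = b then (Fintype.card F : ℂ) else 0) =
      Fintype.card F * ∑ t : Fˣ, if a * t ^ 2 = b then (1 : ℂ) else 0 := by
    simp only [Finset.mul_sum, mul_ite, mul_one, mul_zero]
  rw [sum_unipMult_mul_eq_sum_commuting, sum_bruhat]
  simp only [upper_mul_unip_iff, bigCell_mul_unip_iff, sum_upper_unip hψ, sum_bigCell_unip,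
    Finset.sum_const, Finset.card_univ, nsmul_eq_mul, mul_one, card_units_eq_sub_one]
  rw [← Finset.mul_sum, count]
  field_simp
  ring

open Classical in
lemma sum_borelMult_mul_eq_sum_commuting (χ χ' : Fˣ →* ℂ) :
    ∑ i : Irr ℂ (SL2 F), (borelMult χ (irrep i) : ℂ) * borelMult χ' (irrep i) =
      (((Fintype.card F : ℂ) * (Fintype.card F - 1)) ^ 2)⁻¹ *
        ∑ g : SL2 F, ∑ t : Fˣ, ∑ x : F, ∑ s : Fˣ, ∑ y : F,
          if g * upper s y = upper t x * g then χ t⁻¹ * χ' s else 0 := by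
  simp only [borelMult]
  rw [sum_charMult_mul_charMult, card_borel]
  simp only [sum_borel, borel_subtype_borelEquiv, MonoidHom.comp_apply, map_inv,
    borelDiag_borelEquiv]

lemma sum_upper_upper [DecidableEq F] (χ χ' : Fˣ →* ℂ) (r : Fˣ) (z : F) :
    ∑ t : Fˣ, ∑ x : F, ∑ s : Fˣ, ∑ y : F,
      (if s = t ∧ x = r * (r * y + z * (s : F)⁻¹ - t * z) then χ t⁻¹ * χ' s else 0) =
      Fintype.card F * ∑ t : Fˣ, χ t⁻¹ * χ' t := by
  rw [Finset.mul_sum]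
  refine Finset.sum_congr rfl fun t _ => ?_
  rw [Finset.sum_comm, Finset.sum_eq_single t, Finset.sum_comm]
  · simp
  · intro s _ hs
    simp [hs]
  · simp

lemma sum_bigCell_upper [DecidableEq F] (χ χ' : Fˣ →* ℂ) (c : Fˣ) (a d : F) :
    ∑ t : Fˣ, ∑ x : F, ∑ s : Fˣ, ∑ y : F,
      (if s = t⁻¹ ∧ x = a * ((t : F)⁻¹ - t) * (c : F)⁻¹ ∧ y = d * ((t : F)⁻¹ - t) * (c : F)⁻¹ then
        χ t⁻¹ * χ' s else 0) = ∑ t : Fˣ, (χ * χ') t := by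
  rw [← Equiv.sum_comp (Equiv.inv Fˣ) (fun t => (χ * χ') t)]
  refine Finset.sum_congr rfl fun t _ => ?_
  simp [ite_and]

lemma mul_eq_one_iff_comp_inv_eq {A M : Type*} [CommGroup A] [CommMonoid M] {χ χ' : A →* M} :
    χ * χ' = 1 ↔ χ.comp invMonoidHom = χ' := by
  have inv_mul (t : A) : χ t⁻¹ * χ t = 1 := by rw [← map_mul, inv_mul_cancel, map_one]
  constructor
  · refine fun h => MonoidHom.ext fun t => ?_
    have ht : χ t * χ' t = 1 := DFunLike.congr_fun h t
    calc χ t⁻¹ = χ t⁻¹ * (χ t * χ' t) := by rw [ht, mul_one]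
      _ = χ' t := by rw [← mul_assoc, inv_mul, one_mul]
  · rintro rfl
    exact MonoidHom.ext fun t => (mul_comm _ _).trans (inv_mul t)

open Classical in
lemma sum_inv_mul_units (χ χ' : Fˣ →* ℂ) :
    ∑ t : Fˣ, χ t⁻¹ * χ' t = if χ = χ' then (Fintype.card F : ℂ) - 1 else 0 := by
  have comp_inv_inv : (χ.comp invMonoidHom).comp invMonoidHom = χ :=
    MonoidHom.ext fun t => congrArg χ (inv_inv t)
  have h := sum_hom_units (χ.comp invMonoidHom * χ')
  simp only [mul_eq_one_iff_comp_inv_eq, comp_inv_inv, Nat.cast_ite, card_units_eq_sub_one,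
    Nat.cast_zero] at h
  exact h

open Classical in
lemma sum_borelMult_mul_complex (χ χ' : Fˣ →* ℂ) :
    ∑ i : Irr ℂ (SL2 F), (borelMult χ (irrep i) : ℂ) * borelMult χ' (irrep i) =
      (if χ = χ' then 1 else 0) + if χ * χ' = 1 then 1 else 0 := by
  have hq : (Fintype.card F : ℂ) ≠ 0 := by simp
  have hq' := card_sub_one_ne_zero (F := F)
  rw [sum_borelMult_mul_eq_sum_commuting, sum_bruhat]
  simp only [upper_mul_upper_iff, bigCell_mul_upper_iff, sum_upper_upper, sum_bigCell_upper,
    sum_hom_units, sum_inv_mul_units, Finset.sum_const, Finset.card_univ, nsmul_eq_mul,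
    card_units_eq_sub_one, Nat.cast_ite, Nat.cast_zero]
  split_ifs <;> field_simp <;> ring

lemma sum_borelMult_mul_finrank (χ : Fˣ →* ℂ) :
    ∑ i : Irr ℂ (SL2 F), borelMult χ (irrep i) * Module.finrank ℂ (irrep i) =
      Fintype.card F + 1 := by
  classical
  have hq : (Fintype.card F : ℂ) ≠ 0 := by simp
  have hq' := card_sub_one_ne_zero (F := F)
  have h := sum_charMult_mul_finrank (k := ℂ) (χ.comp borelDiag)
    (Subgroup.subtype_injective (borel F))
  rw [card_borel, card_SL2, inv_mul_eq_div, mul_div_cancel_left₀ _ (mul_ne_zero hq hq')] at h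
  exact_mod_cast h

end MackeySums

section FourierInversion

variable {F : Type u} [Field F] [Fintype F] {ψ : AddChar F ℂ}

lemma char_unip (hψ : ψ.IsPrimitive) (V : FDRep ℂ (SL2 F)) (x : F) :
    V.character (unip (.ofAdd x)) = ∑ a : F, (unipMult ψ a V : ℂ) * ψ (a * x) := by
  classical
  have expand (a : F) : (unipMult ψ a V : ℂ) * ψ (a * x) = ∑ y : F, (Fintype.card F : ℂ)⁻¹ *
      V.character (unip (.ofAdd y)) * ψ (a * (x - y)) := by
    rw [unipMult_eq, mul_assoc, Finset.sum_mul, Finset.mul_sum]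
    refine Finset.sum_congr rfl fun y _ => ?_
    rw [show a * (x - y) = -(a * y) + a * x by ring, AddChar.map_add_eq_mul]
    ring
  rw [Finset.sum_congr rfl fun a _ => expand a, Finset.sum_comm]
  simp only [← Finset.mul_sum, AddChar.sum_mulShift _ hψ, sub_eq_zero]
  simp [mul_right_comm]

lemma finrank_eq_sum_unipMult (hψ : ψ.IsPrimitive) (V : FDRep ℂ (SL2 F)) :
    Module.finrank ℂ V = ∑ a : F, unipMult ψ a V := by
  have h := char_unip hψ V 0
  rw [ofAdd_zero, map_one, FDRep.char_one] at h
  simp only [mul_zero, AddChar.map_zero_eq_one, mul_one] at h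
  exact_mod_cast h

omit [Fintype F] in
lemma char_unip_sq_mul (V : FDRep ℂ (SL2 F)) (t : Fˣ) (x : F) :
    V.character (unip (.ofAdd (t ^ 2 * x))) = V.character (unip (.ofAdd x)) := by
  rw [← V.char_conj (unip (.ofAdd x)) (upper t 0),
    (upper_mul_unip_iff t 0 (t ^ 2 * x) x).2 rfl, mul_inv_cancel_right]

omit [Fintype F] in
lemma unipMult_mul_sq [Finite F] (ψ : AddChar F ℂ) (a : F) (t : Fˣ) (V : FDRep ℂ (SL2 F)) :
    unipMult ψ (a * t ^ 2) V = unipMult ψ a V := by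
  have := Fintype.ofFinite F
  have : (unipMult ψ (a * t ^ 2) V : ℂ) = unipMult ψ a V := by
    rw [unipMult_eq, unipMult_eq, ← Equiv.sum_comp (Units.mulLeft (t ^ 2)) fun x =>
      ψ (-(a * x)) * V.character (unip (.ofAdd x))]
    refine congrArg _ (Finset.sum_congr rfl fun x _ => ?_)
    rw [Units.mulLeft_apply, Units.val_pow_eq_pow_val, char_unip_sq_mul, mul_assoc]
  exact_mod_cast this

lemma unipMult_tensor (hψ : ψ.IsPrimitive) (c : F) (V W : FDRep ℂ (SL2 F)) :
    unipMult ψ c (V ⊗ W) = ∑ a : F, unipMult ψ a V * unipMult ψ (c - a) W := by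
  have : (unipMult ψ c (V ⊗ W) : ℂ) =
      ∑ a : F, (unipMult ψ a V : ℂ) * unipMult ψ (c - a) W := by
    simp only [unipMult_eq ψ _ W]
    rw [unipMult_eq]
    simp only [FDRep.char_tensor, Pi.mul_apply, char_unip hψ V, Finset.mul_sum, Finset.sum_mul]
    rw [Finset.sum_comm]
    refine Finset.sum_congr rfl fun a _ => Finset.sum_congr rfl fun x _ => ?_
    rw [show -((c - a) * x) = -(c * x) + a * x by ring, AddChar.map_add_eq_mul]
    ring
  exact_mod_cast this

omit [Fintype F]

/-- Additive characters of `Additive Fˣ`, for which the library has the duality theory of finite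
abelian groups, viewed as characters of `Fˣ`. -/
def unitsCharEquiv : AddChar (Additive Fˣ) ℂ ≃ (Fˣ →* ℂ) where
  toFun θ :=
    { toFun t := θ (.ofMul t)
      map_one' := θ.map_zero_eq_one
      map_mul' _ _ := θ.map_add_eq_mul _ _ }
  invFun χ :=
    { toFun t := χ t.toMul
      map_zero_eq_one' := χ.map_one
      map_add_eq_mul' _ _ := χ.map_mul _ _ }
  left_inv _ := rfl
  right_inv _ := rfl

instance [Finite F] : Fintype (Fˣ →* ℂ) := Fintype.ofEquiv _ unitsCharEquiv

lemma sum_units_char [Fintype F] [DecidableEq F] (t : Fˣ) :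
    ∑ χ : Fˣ →* ℂ, χ t = if t = 1 then (Fintype.card F : ℂ) - 1 else 0 := by
  rw [← Equiv.sum_comp (unitsCharEquiv (F := F))]
  change ∑ θ : AddChar (Additive Fˣ) ℂ, θ (.ofMul t) = _
  rw [AddChar.sum_apply_eq_ite]
  simp only [ofMul_eq_zero, Fintype.card_additive, card_units_eq_sub_one]

lemma unipMult_zero_eq_sum [Finite F] (ψ : AddChar F ℂ) (V : FDRep ℂ (SL2 F)) :
    unipMult ψ 0 V = ∑ χ : Fˣ →* ℂ, borelMult χ V := by
  classical
  have := Fintype.ofFinite F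
  have upper_one (x : F) : upper 1 x = unip (.ofAdd x) := by
    rw [SL2_ext_iff]; simp
  have hq : (Fintype.card F : ℂ) ≠ 0 := by simp
  have hq' := card_sub_one_ne_zero (F := F)
  have : (unipMult ψ 0 V : ℂ) = ∑ χ : Fˣ →* ℂ, (borelMult χ V : ℂ) := by
    simp only [borelMult_eq, ← Finset.mul_sum]
    rw [Finset.sum_comm]
    simp only [← Finset.sum_mul, sum_units_char, inv_eq_one, ite_mul, zero_mul]
    rw [Finset.sum_ite_eq' Finset.univ, if_pos (Finset.mem_univ _), unipMult_eq]
    simp only [upper_one, zero_mul, neg_zero, AddChar.map_zero_eq_one, one_mul]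
    field_simp
  exact_mod_cast this

end FourierInversion

section WhittakerModels

variable {F : Type u} [Field F]

/-- The anti-involution of `SL2 F` exchanging the diagonal entries. -/
def flipDiag (g : SL2 F) : SL2 F :=
  ⟨!![g.1 1 1, g.1 0 1; g.1 1 0, g.1 0 0], by
    rw [Matrix.det_fin_two_of]
    linear_combination SL2_det g⟩

lemma flipDiag_mul (g h : SL2 F) : flipDiag (g * h) = flipDiag h * flipDiag g := by
  rw [SL2_ext_iff]
  simp only [SL2_mul_apply]
  simp only [flipDiag, SL2_mul_apply, Matrix.of_apply, Matrix.cons_val', Matrix.cons_val_zero,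
    Matrix.cons_val_one, Matrix.cons_val_fin_one]
  refine ⟨by ring, by ring, by ring, by ring⟩

lemma flipDiag_unip (x : Multiplicative F) : flipDiag (unip x) = unip x :=
  SL2_ext_iff.2 ⟨rfl, rfl, rfl, rfl⟩

lemma flipDiag_upper (t : Fˣ) (x : F) : flipDiag (upper t x) = upper t⁻¹ x :=
  SL2_ext_iff.2 ⟨rfl, rfl, rfl, by simp [flipDiag]⟩

lemma flipDiag_bigCell (c : Fˣ) (a d : F) : flipDiag (bigCell c a d) = bigCell c d a :=
  SL2_ext_iff.2 ⟨rfl, by simp [flipDiag, mul_comm], rfl, rfl⟩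

lemma bigCell_eq_unip_mul_mul_unip (c : Fˣ) (a d : F) :
    bigCell c a d = unip (.ofAdd (a * (c : F)⁻¹)) * bigCell c 0 0 *
      unip (.ofAdd (d * (c : F)⁻¹)) := by
  rw [SL2_ext_iff]
  simp only [SL2_mul_apply, bigCell_apply_00, bigCell_apply_01, bigCell_apply_10,
    bigCell_apply_11, unip_apply_00, unip_apply_01, unip_apply_10, unip_apply_11, toAdd_ofAdd,
    Units.val_inv_eq_inv_val]
  refine ⟨by field_simp; ring, by field_simp; ring, by ring, by field_simp; ring⟩

variable [Fintype F] {V : FDRep ℂ (SL2 F)} {φ : AddChar F ℂ}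

lemma heckeOp_upper_eq_zero (hφ : φ.IsPrimitive) {t : Fˣ} (ht : t ≠ t⁻¹) (z : F) :
    heckeOp unip φ.toMonoidHom V (upper t z) = 0 := by
  have ht' : (t : F) ^ 2 - 1 ≠ 0 := fun h => ht <| by
    rw [eq_inv_iff_mul_eq_one]
    ext
    push_cast
    linear_combination h
  obtain ⟨x, hx⟩ := AddChar.ne_one_iff.1 (hφ ht')
  have scaled : φ (t ^ 2 * x) • heckeOp unip φ.toMonoidHom V (upper t z) =
      φ x • heckeOp unip φ.toMonoidHom V (upper t z) := by
    have hl := heckeOp_map_mul_mul_map unip φ.toMonoidHom V (upper t z) (.ofAdd (t ^ 2 * x)) 1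
    have hr := heckeOp_map_mul_mul_map unip φ.toMonoidHom V (upper t z) 1 (.ofAdd x)
    rw [map_one, map_one, mul_one, mul_one, ← (upper_mul_unip_iff t z (t ^ 2 * x) x).2 rfl] at hl
    rw [map_one, map_one, one_mul, one_mul, hl] at hr
    exact hr
  by_contra hne
  refine hx ?_
  rw [AddChar.mulShift_apply, show ((t : F) ^ 2 - 1) * x = t ^ 2 * x - x by ring,
    AddChar.map_sub_eq_div, smul_left_injective ℂ hne scaled, ← AddChar.map_sub_eq_div, sub_self,
    AddChar.map_zero_eq_one]

lemma heckeOp_flipDiag (hφ : φ.IsPrimitive) (g : SL2 F) :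
    heckeOp unip φ.toMonoidHom V (flipDiag g) = heckeOp unip φ.toMonoidHom V g := by
  by_cases hg : g.1 1 0 = 0
  · obtain ⟨t, x, rfl⟩ := exists_eq_upper hg
    rw [flipDiag_upper]
    by_cases ht : t = t⁻¹
    · rw [← ht]
    · rw [heckeOp_upper_eq_zero hφ ht,
        heckeOp_upper_eq_zero hφ fun h => ht ((inv_inv t).symm.trans h.symm)]
  · obtain ⟨c, a, d, rfl⟩ := exists_eq_bigCell hg
    rw [flipDiag_bigCell, bigCell_eq_unip_mul_mul_unip c a, bigCell_eq_unip_mul_mul_unip c d,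
      heckeOp_map_mul_mul_map, heckeOp_map_mul_mul_map, mul_comm (φ.toMonoidHom _)]

omit [Fintype F] in
lemma unipMult_le_one [Finite F] {ψ : AddChar F ℂ} (hψ : ψ.IsPrimitive) {a : F} (ha : a ≠ 0)
    (V : FDRep ℂ (SL2 F)) [Simple V] : unipMult ψ a V ≤ 1 :=
  have := Fintype.ofFinite F
  charMult_le_one _ _ _ flipDiag_mul flipDiag_unip
    (heckeOp_flipDiag (AddChar.IsPrimitive.of_ne_one (hψ ha)))

end WhittakerModels

section SquareClasses

variable {F : Type u} [Field F] {ψ : AddChar F ℂ} {ε : F}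

lemma ne_zero_of_not_isSquare (hε : ¬ IsSquare ε) : ε ≠ 0 := fun h => hε (h ▸ IsSquare.zero)

lemma ringChar_ne_two_of_not_isSquare [Finite F] (hε : ¬ IsSquare ε) : ringChar F ≠ 2 := fun h =>
  hε (FiniteField.isSquare_of_char_two h ε)

lemma three_le_card [Fintype F] (hε : ¬ IsSquare ε) : 3 ≤ Fintype.card F := by
  have odd_card := FiniteField.odd_card_of_char_ne_two (ringChar_ne_two_of_not_isSquare hε)
  have one_lt_card := Fintype.one_lt_card (α := F)
  omega

lemma exists_mul_sq_eq_of_not_isSquare [Finite F] {a : F} (hε : ¬ IsSquare ε)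
    (ha : ¬ IsSquare a) : ∃ t : Fˣ, ε * (t : F) ^ 2 = a := by
  classical
  have := Fintype.ofFinite F
  have hε0 := ne_zero_of_not_isSquare hε
  have ha0 := ne_zero_of_not_isSquare ha
  have quadraticChar_mul : quadraticChar F (a * ε) = 1 := by
    rw [map_mul, quadraticChar_neg_one_iff_not_isSquare.2 ha,
      quadraticChar_neg_one_iff_not_isSquare.2 hε, neg_one_mul, neg_neg]
  obtain ⟨s, hs⟩ := (quadraticChar_one_iff_isSquare (mul_ne_zero ha0 hε0)).1 quadraticChar_mul
  have hs0 : s ≠ 0 := by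
    rintro rfl
    exact mul_ne_zero ha0 hε0 (by rw [hs, mul_zero])
  refine ⟨Units.mk0 (s / ε) (div_ne_zero hs0 hε0), ?_⟩
  rw [Units.val_mk0]
  field_simp
  linear_combination -hs

lemma unipMult_eq_of_isSquare [Finite F] {a : F} (ha0 : a ≠ 0) (ha : IsSquare a)
    (V : FDRep ℂ (SL2 F)) : unipMult ψ a V = unipMult ψ 1 V := by
  obtain ⟨t, rfl⟩ := ha
  rw [← unipMult_mul_sq ψ 1 (Units.mk0 t (left_ne_zero_of_mul ha0)), Units.val_mk0, one_mul, sq]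

lemma unipMult_eq_of_not_isSquare [Finite F] {a : F} (hε : ¬ IsSquare ε) (ha : ¬ IsSquare a)
    (V : FDRep ℂ (SL2 F)) : unipMult ψ a V = unipMult ψ ε V := by
  obtain ⟨t, rfl⟩ := exists_mul_sq_eq_of_not_isSquare hε ha
  exact unipMult_mul_sq ψ ε t V

variable [Fintype F]

lemma two_mul_finrank (hψ : ψ.IsPrimitive) (hε : ¬ IsSquare ε) (V : FDRep ℂ (SL2 F)) :
    2 * (Module.finrank ℂ V : ℤ) =
      2 * unipMult ψ 0 V + (Fintype.card F - 1) * (unipMult ψ 1 V + unipMult ψ ε V) := by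
  classical
  have by_quadraticChar (a : F) : 2 * (unipMult ψ a V : ℤ) =
      (unipMult ψ 1 V + unipMult ψ ε V) +
      quadraticChar F a * (unipMult ψ 1 V - unipMult ψ ε V) +
      if a = 0 then 2 * (unipMult ψ 0 V : ℤ) - (unipMult ψ 1 V + unipMult ψ ε V) else 0 := by
    split_ifs with ha0
    · rw [ha0, quadraticChar_zero]; ring
    · by_cases ha : IsSquare a
      · rw [unipMult_eq_of_isSquare ha0 ha, (quadraticChar_one_iff_isSquare ha0).2 ha]; ring
      · rw [unipMult_eq_of_not_isSquare hε ha, quadraticChar_neg_one_iff_not_isSquare.2 ha]; ring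
  rw [finrank_eq_sum_unipMult hψ, Nat.cast_sum, Finset.mul_sum,
    Finset.sum_congr rfl fun a _ => by_quadraticChar a, Finset.sum_add_distrib,
    Finset.sum_add_distrib, ← Finset.sum_mul,
    quadraticChar_sum_zero (ringChar_ne_two_of_not_isSquare hε)]
  simp only [Finset.sum_const, Finset.card_univ, nsmul_eq_mul, zero_mul, add_zero,
    Finset.sum_ite_eq', Finset.mem_univ, if_true]
  ring

lemma sum_ite_sq_eq_one (hF : ringChar F ≠ 2) [DecidableEq F] :
    ∑ t : Fˣ, (if (t : F) ^ 2 = 1 then (1 : ℂ) else 0) = 2 := by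
  have roots : (Finset.univ.filter fun t : Fˣ => (t : F) ^ 2 = 1) = {1, -1} := by
    ext t
    simp only [Finset.mem_filter, Finset.mem_univ, true_and, Finset.mem_insert,
      Finset.mem_singleton, sq_eq_one_iff, Units.ext_iff, Units.val_neg, Units.val_one]
  have one_ne_neg_one : (1 : Fˣ) ≠ -1 := fun h =>
    Ring.neg_one_ne_one_of_char_ne_two hF (by simpa using (congrArg Units.val h).symm)
  rw [Finset.sum_boole, roots, Finset.card_pair one_ne_neg_one, Nat.cast_ofNat]

omit [Fintype F] in
lemma sum_unipMult_sub_sq [Finite F] (hψ : ψ.IsPrimitive) (hε : ¬ IsSquare ε) :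
    ∑ i : Irr ℂ (SL2 F), ((unipMult ψ 1 (irrep i) : ℂ) - unipMult ψ ε (irrep i)) ^ 2 = 4 := by
  classical
  have := Fintype.ofFinite F
  have sq_ne (t : Fˣ) : (t : F) ^ 2 ≠ ε := fun h => hε (h ▸ IsSquare.sq _)
  have sum_one_one := sum_unipMult_mul hψ 1 1
  have sum_ε_ε := sum_unipMult_mul hψ ε ε
  have sum_one_ε := sum_unipMult_mul hψ 1 ε
  simp only [one_mul, mul_eq_left₀ (ne_zero_of_not_isSquare hε),
    sum_ite_sq_eq_one (ringChar_ne_two_of_not_isSquare hε), sq_ne, if_false,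
    Finset.sum_const_zero] at sum_one_one sum_ε_ε sum_one_ε
  have expand (x y : ℂ) : (x - y) ^ 2 = x * x + y * y - 2 * (x * y) := by ring
  simp only [expand, Finset.sum_sub_distrib, Finset.sum_add_distrib, ← Finset.mul_sum,
    sum_one_one, sum_ε_ε, sum_one_ε]
  ring

omit [Fintype F] in
lemma card_unipMult_ne [Finite F] (hψ : ψ.IsPrimitive) (hε : ¬ IsSquare ε) :
    (Finset.univ.filter fun i : Irr ℂ (SL2 F) =>
      unipMult ψ 1 (irrep i) ≠ unipMult ψ ε (irrep i)).card = 4 := by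
  have sub_sq_eq (i : Irr ℂ (SL2 F)) :
      ((unipMult ψ 1 (irrep i) : ℂ) - unipMult ψ ε (irrep i)) ^ 2 =
        if unipMult ψ 1 (irrep i) ≠ unipMult ψ ε (irrep i) then 1 else 0 := by
    have one_le := unipMult_le_one hψ one_ne_zero (irrep i)
    have ε_le := unipMult_le_one hψ (ne_zero_of_not_isSquare hε) (irrep i)
    interval_cases unipMult ψ 1 (irrep i) <;> interval_cases unipMult ψ ε (irrep i) <;> simp
  have := sum_unipMult_sub_sq hψ hε
  simp only [sub_sq_eq, Finset.sum_boole] at this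
  exact_mod_cast this

end SquareClasses

section BorelConstituents

lemma le_one_of_sum_mul_self_lt_four {ι : Type*} [Fintype ι] {b : ι → ℕ}
    (h : ∑ i, b i * b i < 4) (i : ι) : b i ≤ 1 := by
  have := Finset.single_le_sum (f := fun i => b i * b i) (fun _ _ => Nat.zero_le _)
    (Finset.mem_univ i)
  by_contra!
  nlinarith

lemma card_eq_one_of_sum_mul_self_lt_four {ι : Type*} [Fintype ι] {b : ι → ℕ}
    (h : ∑ i, b i * b i < 4) :
    (Finset.univ.filter fun i => b i = 1).card = ∑ i, b i * b i := by
  have mul_self (i : ι) : b i * b i = if b i = 1 then 1 else 0 := by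
    have := le_one_of_sum_mul_self_lt_four h i
    interval_cases b i <;> simp
  simp only [mul_self, Finset.sum_boole, Nat.cast_id]

variable {F : Type u} [Field F] {ψ : AddChar F ℂ} {χ : Fˣ →* ℂ} {V : FDRep ℂ (SL2 F)}

lemma borelMult_trivial : 0 < borelMult (1 : Fˣ →* ℂ) (𝟙_ (FDRep ℂ (SL2 F))) :=
  (charMult_pos_iff).2 ⟨show ℂ from 1,
    mem_eigenvectors.2 fun _ => (one_smul ℂ (1 : ℂ)).symm, one_ne_zero (α := ℂ)⟩

variable [Finite F]

open Classical in
lemma sum_borelMult_mul (χ χ' : Fˣ →* ℂ) :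
    ∑ i : Irr ℂ (SL2 F), borelMult χ (irrep i) * borelMult χ' (irrep i) =
      (if χ = χ' then 1 else 0) + if χ * χ' = 1 then 1 else 0 := by
  have := Fintype.ofFinite F
  rw [← Nat.cast_inj (R := ℂ)]
  push_cast
  convert sum_borelMult_mul_complex χ χ'

open Classical in
lemma borelMult_mul_le (χ χ' : Fˣ →* ℂ) (V : FDRep ℂ (SL2 F)) [Simple V] :
    borelMult χ V * borelMult χ' V ≤
      (if χ = χ' then 1 else 0) + if χ * χ' = 1 then 1 else 0 := by
  have := Fintype.ofFinite F
  obtain ⟨i, ⟨e⟩⟩ := exists_iso_irrep V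
  rw [borelMult_congr e, borelMult_congr e, ← sum_borelMult_mul]
  exact Finset.single_le_sum (f := fun i => borelMult χ (irrep i) * borelMult χ' (irrep i))
    (fun _ _ => Nat.zero_le _) (Finset.mem_univ i)

lemma borelMult_le_one (χ : Fˣ →* ℂ) (V : FDRep ℂ (SL2 F)) [Simple V] : borelMult χ V ≤ 1 := by
  classical
  have mul_self_le := borelMult_mul_le χ χ V
  have : borelMult χ V * borelMult χ V ≤ 2 := mul_self_le.trans (by split_ifs <;> simp)
  nlinarith

lemma unipMult_zero_le_two [Simple V] (h : 0 < borelMult χ V) : unipMult ψ 0 V ≤ 2 := by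
  classical
  rw [unipMult_zero_eq_sum]
  calc ∑ θ : Fˣ →* ℂ, borelMult θ V ≤ ∑ θ, borelMult χ V * borelMult θ V :=
        Finset.sum_le_sum fun θ _ => Nat.le_mul_of_pos_left _ h
    _ ≤ ∑ θ, ((if χ = θ then 1 else 0) + if χ * θ = 1 then 1 else 0) :=
        Finset.sum_le_sum fun θ _ => borelMult_mul_le χ θ V
    _ = 2 := by simp [Finset.sum_add_distrib, mul_eq_one_iff_comp_inv_eq]

lemma unipMult_zero_eq_one (hχ : χ * χ = 1) [Simple V] (h : 0 < borelMult χ V) :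
    unipMult ψ 0 V = 1 := by
  classical
  have borelMult_eq_one : borelMult χ V = 1 := le_antisymm (borelMult_le_one χ V) h
  rw [unipMult_zero_eq_sum, Fintype.sum_eq_single χ, borelMult_eq_one]
  intro θ hθ
  have mul_ne_one : χ * θ ≠ 1 := fun h => hθ <| by
    rw [← mul_one χ, ← h, ← mul_assoc, hχ, one_mul]
  have := borelMult_mul_le χ θ V
  rwa [if_neg hθ.symm, if_neg mul_ne_one, borelMult_eq_one, one_mul, add_zero,
    Nat.le_zero] at this

omit [Finite F] in
variable [Fintype F] in
lemma finrank_eq_of_borelMult_pos (hχ : χ * χ ≠ 1) [Simple V] (h : 0 < borelMult χ V) :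
    Module.finrank ℂ V = Fintype.card F + 1 := by
  classical
  obtain ⟨i, ⟨e⟩⟩ := exists_iso_irrep V
  have borelMult_i : borelMult χ (irrep i) = 1 :=
    borelMult_congr e χ ▸ le_antisymm (borelMult_le_one χ V) h
  have sum_mul_self := sum_borelMult_mul χ χ
  rw [if_pos rfl, if_neg hχ, ← Finset.add_sum_erase _ _ (Finset.mem_univ i), borelMult_i,
    mul_one, Nat.add_left_cancel_iff, Finset.sum_eq_zero_iff] at sum_mul_self
  rw [finrank_eq_of_iso e, ← sum_borelMult_mul_finrank χ, Fintype.sum_eq_single i,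
    borelMult_i, one_mul]
  intro j hj
  rw [mul_self_eq_zero.1 (sum_mul_self j (Finset.mem_erase.2 ⟨hj, Finset.mem_univ j⟩)), zero_mul]

omit [Finite F] in
variable [Fintype F] in
lemma exists_pair_of_mul_self_eq_one (hχ : χ * χ = 1) :
    ∃ i j : Irr ℂ (SL2 F), i ≠ j ∧ (∀ k, borelMult χ (irrep k) = 1 ↔ k = i ∨ k = j) ∧
      Module.finrank ℂ (irrep i) + Module.finrank ℂ (irrep j) = Fintype.card F + 1 := by
  classical
  have sum_mul_self := sum_borelMult_mul χ χ
  rw [if_pos rfl, if_pos hχ] at sum_mul_self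
  obtain ⟨i, j, hij, support⟩ := Finset.card_eq_two.1
    ((card_eq_one_of_sum_mul_self_lt_four (sum_mul_self.trans_lt (by norm_num))).trans
      sum_mul_self)
  have borelMult_eq_one_iff (k : Irr ℂ (SL2 F)) :
      borelMult χ (irrep k) = 1 ↔ k = i ∨ k = j := by
    simpa using Finset.ext_iff.1 support k
  refine ⟨i, j, hij, borelMult_eq_one_iff, ?_⟩
  rw [← sum_borelMult_mul_finrank χ, Fintype.sum_eq_add i j hij,
    (borelMult_eq_one_iff i).2 (.inl rfl), (borelMult_eq_one_iff j).2 (.inr rfl), one_mul, one_mul]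
  rintro k ⟨hki, hkj⟩
  have ne_one := (borelMult_eq_one_iff k).not.2 (by simp [hki, hkj])
  have le_one := borelMult_le_one χ (irrep k)
  rw [Nat.lt_one_iff.1 (lt_of_le_of_ne le_one ne_one), zero_mul]

end BorelConstituents

section UnipotentGeneration

variable {F : Type u} [Field F]

lemma bigCell_one_one_eq_conj_unip (c : Fˣ) :
    bigCell c 1 1 = bigCell 1 0 0 * unip (.ofAdd (-c : F)) * (bigCell 1 0 0)⁻¹ := by
  rw [eq_mul_inv_iff_mul_eq, SL2_ext_iff]
  simp only [SL2_mul_apply, unip_apply_00, unip_apply_01, unip_apply_10, unip_apply_11,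
    bigCell_apply_00, bigCell_apply_01, bigCell_apply_10, bigCell_apply_11, toAdd_ofAdd, inv_one,
    Units.val_one]
  refine ⟨by ring, by ring, by ring, by ring⟩

lemma upper_eq_mul (t : Fˣ) (x : F) :
    upper t x = unip (.ofAdd (t : F)) * bigCell (-t⁻¹) 1 1 * unip (.ofAdd (t : F)) *
      unip (.ofAdd (-1)) * bigCell 1 1 1 * unip (.ofAdd (-1)) *
        unip (.ofAdd ((t : F)⁻¹ * x)) := by
  have ht : (t : F) ≠ 0 := t.ne_zero
  rw [SL2_ext_iff]
  simp only [SL2_mul_apply, unip_apply_00, unip_apply_01, unip_apply_10, unip_apply_11,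
    upper_apply_00, upper_apply_01, upper_apply_10, upper_apply_11, bigCell_apply_00,
    bigCell_apply_01, bigCell_apply_10, bigCell_apply_11, toAdd_ofAdd, Units.val_neg,
    Units.val_one, Units.val_inv_eq_inv_val]
  refine ⟨by field_simp; ring, by field_simp; ring, by field_simp; ring, by field_simp; ring⟩

lemma upper_mem_of_unip_mem {N : Subgroup (SL2 F)} [N.Normal]
    (hN : ∀ x : F, unip (.ofAdd x) ∈ N) (t : Fˣ) (x : F) : upper t x ∈ N := by
  have bigCell_mem (c : Fˣ) : bigCell c 1 1 ∈ N := by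
    rw [bigCell_one_one_eq_conj_unip]
    exact ‹N.Normal›.conj_mem _ (hN _) _
  rw [upper_eq_mul]
  exact mul_mem (mul_mem (mul_mem (mul_mem (mul_mem (mul_mem (hN _) (bigCell_mem _)) (hN _))
    (hN _)) (bigCell_mem _)) (hN _)) (hN _)

end UnipotentGeneration

section TrivialRepresentation

variable {k : Type u} [Field k] {G : Type v} [Group G]

lemma finrank_trivial : Module.finrank k (𝟙_ (FDRep k G)) = 1 := Module.finrank_self k

lemma finrank_eq_one_of_iso_trivial {V : FDRep k G} (h : Nonempty (V ≅ 𝟙_ (FDRep k G))) :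
    Module.finrank k V = 1 :=
  h.elim fun e => (finrank_eq_of_iso e).trans finrank_trivial

instance [CharZero k] [Finite G] : Simple (𝟙_ (FDRep k G)) := by
  have not_isZero : ¬ IsZero (𝟙_ (FDRep k G)) := by
    rw [← finrank_eq_zero_iff, finrank_trivial]
    exact one_ne_zero
  by_contra not_simple
  obtain ⟨W₁, W₂, ⟨e⟩, h₁, h₂⟩ := exists_iso_biprod_of_not_simple not_isZero not_simple
  have finrank_add := finrank_eq_of_iso e
  rw [finrank_biprod, finrank_trivial] at finrank_add
  rw [← finrank_pos_iff] at h₁ h₂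
  omega

end TrivialRepresentation

section Classification

variable {F : Type u} [Field F] {ψ : AddChar F ℂ} {ε : F} {V : FDRep ℂ (SL2 F)}

lemma finrank_of_borelMult_one [Fintype F] [Simple V] (h : 0 < borelMult 1 V)
    (hV : ¬ Nonempty (V ≅ 𝟙_ (FDRep ℂ (SL2 F)))) : Module.finrank ℂ V = Fintype.card F := by
  obtain ⟨i, j, -, borelMult_eq_one_iff, finrank_add⟩ :=
    exists_pair_of_mul_self_eq_one (F := F) (mul_one 1)
  obtain ⟨k, ⟨eV⟩⟩ := exists_iso_irrep V
  obtain ⟨l, ⟨e1⟩⟩ := exists_iso_irrep (𝟙_ (FDRep ℂ (SL2 F)))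
  have hk := (borelMult_eq_one_iff k).1 <| le_antisymm (borelMult_le_one _ _) <|
    borelMult_congr eV 1 ▸ h
  have hl := (borelMult_eq_one_iff l).1 <| le_antisymm (borelMult_le_one _ _) <|
    borelMult_congr e1 1 ▸ borelMult_trivial
  have hkl : k ≠ l := by
    rintro rfl
    exact hV ⟨eV ≪≫ e1.symm⟩
  have finrank_l := finrank_eq_one_of_iso_trivial ⟨e1.symm⟩
  rw [finrank_eq_of_iso eV]
  rcases hk with rfl | rfl <;> rcases hl with rfl | rfl
  · exact absurd rfl hkl
  · omega
  · omega
  · exact absurd rfl hkl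

lemma unipMult_eq_one_of_le_finrank [Fintype F] (hψ : ψ.IsPrimitive) (hε : ¬ IsSquare ε)
    [Simple V] (h : Fintype.card F + unipMult ψ 0 V ≤ Module.finrank ℂ V + 1) :
    unipMult ψ 1 V = 1 ∧ unipMult ψ ε V = 1 := by
  have le_one := unipMult_le_one hψ one_ne_zero V
  have le_one' := unipMult_le_one hψ (ne_zero_of_not_isSquare hε) V
  have card_ge := three_le_card hε
  have finrank_eq := two_mul_finrank hψ hε V
  have two_le : 2 ≤ (unipMult ψ 1 V : ℤ) + unipMult ψ ε V := by
    refine le_of_mul_le_mul_left (a := (Fintype.card F : ℤ) - 1) ?_ (by omega)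
    omega
  omega

lemma unip_eq_one_of_unipMult_eq_zero [Finite F] (hψ : ψ.IsPrimitive) (hε : ¬ IsSquare ε)
    (h1 : unipMult ψ 1 V = 0) (hε0 : unipMult ψ ε V = 0) (x : F) :
    V.ρ (unip (.ofAdd x)) = 1 := by
  have := Fintype.ofFinite F
  have finrank_eq : Module.finrank ℂ V = unipMult ψ 0 V := by
    have := two_mul_finrank hψ hε V
    rw [h1, hε0, Nat.cast_zero, add_zero, mul_zero, add_zero] at this
    omega
  have eigenvectors_eq_top : eigenvectors unip (AddChar.mulShift ψ 0).toMonoidHom V = ⊤ :=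
    Submodule.eq_top_of_finrank_eq finrank_eq.symm
  ext v
  have hv : v ∈ eigenvectors unip (AddChar.mulShift ψ 0).toMonoidHom V :=
    eigenvectors_eq_top ▸ Submodule.mem_top
  refine (mem_eigenvectors.1 hv (.ofAdd x)).trans ?_
  change ψ (0 * x) • v = v
  rw [zero_mul, AddChar.map_zero_eq_one, one_smul]

lemma borelMult_one_pos_of_unip_eq_one [Simple V] (h : ∀ x : F, V.ρ (unip (.ofAdd x)) = 1) :
    0 < borelMult 1 V := by
  obtain ⟨v, hv⟩ := (Module.finrank_pos_iff_exists_ne_zero (R := ℂ)).1 (finrank_pos_of_simple V)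
  refine charMult_pos_iff.2 ⟨v, mem_eigenvectors.2 fun b => ?_, hv⟩
  obtain ⟨⟨t, x⟩, rfl⟩ := borelEquiv.surjective b
  have : V.ρ (upper t x) = 1 := upper_mem_of_unip_mem (N := MonoidHom.ker V.ρ) h t x
  rw [borel_subtype_borelEquiv, this]
  exact (one_smul ℂ v).symm

lemma trivial_of_unipMult_eq_zero [Finite F] (hψ : ψ.IsPrimitive) (hε : ¬ IsSquare ε)
    [Simple V] (h1 : unipMult ψ 1 V = 0) (hε0 : unipMult ψ ε V = 0) :
    Nonempty (V ≅ 𝟙_ (FDRep ℂ (SL2 F))) := by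
  have := Fintype.ofFinite F
  by_contra hV
  have borelMult_pos := borelMult_one_pos_of_unip_eq_one
    (unip_eq_one_of_unipMult_eq_zero hψ hε h1 hε0)
  have := unipMult_eq_one_of_le_finrank hψ hε (V := V) <| by
    rw [finrank_of_borelMult_one borelMult_pos hV, unipMult_zero_eq_one (mul_one 1) borelMult_pos]
  omega

lemma unipMult_add_pos_of_quadratic [Finite F] (hψ : ψ.IsPrimitive) (hε : ¬ IsSquare ε)
    {χ : Fˣ →* ℂ} (hχ : χ ≠ 1) [Simple V] (h : 0 < borelMult χ V) :
    0 < unipMult ψ 1 V + unipMult ψ ε V := by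
  classical
  by_contra add_eq_zero
  obtain ⟨e⟩ := trivial_of_unipMult_eq_zero hψ hε (V := V) (by omega) (by omega)
  have borelMult_one_pos : 0 < borelMult 1 V := borelMult_congr e 1 ▸ borelMult_trivial
  have mul_le := borelMult_mul_le 1 χ V
  rw [one_mul, if_neg hχ.symm, if_neg hχ] at mul_le
  exact (mul_pos borelMult_one_pos h).not_ge mul_le

lemma unipMult_add_of_quadratic [Finite F] (hψ : ψ.IsPrimitive) (hε : ¬ IsSquare ε)
    {χ : Fˣ →* ℂ} (hχχ : χ * χ = 1) (hχ : χ ≠ 1) [Simple V] (h : 0 < borelMult χ V) :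
    unipMult ψ 1 V + unipMult ψ ε V = 1 := by
  have := Fintype.ofFinite F
  obtain ⟨i, j, -, borelMult_eq_one_iff, finrank_add⟩ := exists_pair_of_mul_self_eq_one hχχ
  obtain ⟨k, ⟨e⟩⟩ := exists_iso_irrep V
  have hk : k = i ∨ k = j := (borelMult_eq_one_iff k).1 <|
    le_antisymm (borelMult_le_one _ _) (borelMult_congr e χ ▸ h)
  have borelMult_i : 0 < borelMult χ (irrep i) :=
    zero_lt_one.trans_eq ((borelMult_eq_one_iff i).2 (.inl rfl)).symm
  have borelMult_j : 0 < borelMult χ (irrep j) :=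
    zero_lt_one.trans_eq ((borelMult_eq_one_iff j).2 (.inr rfl)).symm
  have pos_i := unipMult_add_pos_of_quadratic hψ hε hχ borelMult_i
  have pos_j := unipMult_add_pos_of_quadratic hψ hε hχ borelMult_j
  have finrank_i := two_mul_finrank hψ hε (irrep i)
  have finrank_j := two_mul_finrank hψ hε (irrep j)
  rw [unipMult_zero_eq_one hχχ borelMult_i] at finrank_i
  rw [unipMult_zero_eq_one hχχ borelMult_j] at finrank_j
  have card_sub_one_ne_zero : (Fintype.card F : ℤ) - 1 ≠ 0 := by
    have := three_le_card hε
    omega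
  have sum_eq_two : (unipMult ψ 1 (irrep i) + unipMult ψ ε (irrep i) : ℤ) +
      (unipMult ψ 1 (irrep j) + unipMult ψ ε (irrep j)) = 2 := by
    refine mul_left_cancel₀ card_sub_one_ne_zero ?_
    zify at finrank_add
    linear_combination 2 * finrank_add - finrank_i - finrank_j
  rw [unipMult_congr e, unipMult_congr e]
  rcases hk with rfl | rfl <;> omega

/-- The last case comprises the cuspidal, the principal series and the Steinberg
representations. -/
lemma classification [Finite F] (hψ : ψ.IsPrimitive) (hε : ¬ IsSquare ε)
    (V : FDRep ℂ (SL2 F)) [Simple V] :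
    Nonempty (V ≅ 𝟙_ (FDRep ℂ (SL2 F))) ∨
    (unipMult ψ 0 V ≤ 1 ∧ unipMult ψ 1 V + unipMult ψ ε V = 1) ∨
    (unipMult ψ 0 V ≤ 2 ∧ unipMult ψ 1 V = 1 ∧ unipMult ψ ε V = 1 ∧
      (unipMult ψ 0 V = 1 → 0 < borelMult 1 V)) := by
  have := Fintype.ofFinite F
  rw [or_iff_not_imp_left]
  intro hV
  have le_one := unipMult_le_one hψ one_ne_zero V
  have le_one' := unipMult_le_one hψ (ne_zero_of_not_isSquare hε) V
  have add_ne_zero : unipMult ψ 1 V + unipMult ψ ε V ≠ 0 := fun h =>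
    hV (trivial_of_unipMult_eq_zero hψ hε (by omega) (by omega))
  rcases Nat.eq_zero_or_pos (unipMult ψ 0 V) with cuspidal | pos
  · omega
  obtain ⟨χ, hχ⟩ : ∃ χ : Fˣ →* ℂ, 0 < borelMult χ V := by
    by_contra! borelMult_eq_zero
    rw [unipMult_zero_eq_sum,
      Finset.sum_eq_zero fun χ _ => Nat.le_zero.1 (borelMult_eq_zero χ)] at pos
    exact pos.false
  have le_two := unipMult_zero_le_two (ψ := ψ) hχ
  by_cases hχχ : χ * χ = 1
  · have eq_one := unipMult_zero_eq_one (ψ := ψ) hχχ hχ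
    by_cases hχ1 : χ = 1
    · rw [hχ1] at hχ
      have steinberg := unipMult_eq_one_of_le_finrank hψ hε (V := V) <| by
        rw [finrank_of_borelMult_one hχ hV, eq_one]
      exact .inr ⟨le_two, steinberg.1, steinberg.2, fun _ => hχ⟩
    · exact .inl ⟨eq_one.le, unipMult_add_of_quadratic hψ hε hχχ hχ1 hχ⟩
  · have finrank_eq := finrank_eq_of_borelMult_pos hχχ hχ
    have principal := unipMult_eq_one_of_le_finrank hψ hε (V := V) (by omega)
    have := two_mul_finrank hψ hε V
    rw [finrank_eq, principal.1, principal.2] at this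
    push_cast at this
    exact .inr ⟨le_two, principal.1, principal.2, by omega⟩

end Classification

section Dual

variable {k : Type u} [Field k] {G : Type v} [Group G]

lemma simple_of_finrank_end_eq_one [CharZero k] [Finite G] {V : FDRep k G}
    (h : Module.finrank k (V ⟶ V) = 1) : Simple V := by
  have finrank_end_pos {W : FDRep k G} (hW : ¬ IsZero W) : 0 < Module.finrank k (W ⟶ W) := by
    rw [Module.finrank_pos_iff_exists_ne_zero]
    exact ⟨𝟙 W, mt (IsZero.iff_id_eq_zero W).2 hW⟩
  have not_isZero : ¬ IsZero V := fun hV => by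
    have : Subsingleton (V ⟶ V) := ⟨hV.eq_of_src⟩
    exact zero_ne_one (Module.finrank_zero_of_subsingleton.symm.trans h)
  by_contra not_simple
  obtain ⟨W₁, W₂, ⟨e⟩, h₁, h₂⟩ := exists_iso_biprod_of_not_simple not_isZero not_simple
  rw [finrank_hom_congr_right V e, finrank_hom_biprod_right, finrank_hom_comm V W₁,
    finrank_hom_comm V W₂, finrank_hom_congr_right W₁ e, finrank_hom_congr_right W₂ e,
    finrank_hom_biprod_right, finrank_hom_biprod_right] at h
  have := finrank_end_pos h₁
  have := finrank_end_pos h₂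
  omega

lemma simple_dual [IsAlgClosed k] [CharZero k] [Finite G] (X : FDRep k G) [Simple X] :
    Simple (FDRep.of (Representation.dual X.ρ)) := by
  have := Fintype.ofFinite G
  refine simple_of_finrank_end_eq_one ?_
  have h := card_inv_mul_sum_char_mul_char (FDRep.of (Representation.dual X.ρ))
    (FDRep.of (Representation.dual X.ρ))
  simp only [FDRep.char_dual, inv_inv, mul_comm (X.character _⁻¹)] at h
  rw [card_inv_mul_sum_char_mul_char, FDRep.finrank_hom_simple_simple, if_pos ⟨Iso.refl X⟩] at h
  exact_mod_cast h.symm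

lemma finrank_dual (X : FDRep k G) :
    Module.finrank k (FDRep.of (Representation.dual X.ρ)) = Module.finrank k X :=
  Subspace.dual_finrank_eq

lemma finrank_hom_tensor_dual [CharZero k] [Finite G] (V X Y : FDRep k G) :
    Module.finrank k (V ⟶ Y ⊗ FDRep.of (Representation.dual X.ρ)) =
      Module.finrank k (Y ⟶ V ⊗ X) := by
  have := Fintype.ofFinite G
  rw [finrank_hom_comm Y, ← Nat.cast_inj (R := k), ← card_inv_mul_sum_char_mul_char,
    ← card_inv_mul_sum_char_mul_char]
  congr 1
  refine Finset.sum_congr rfl fun g _ => ?_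
  rw [FDRep.char_tensor, FDRep.char_tensor, Pi.mul_apply, Pi.mul_apply, FDRep.char_dual]
  ring

lemma exists_mono_of_finrank_pos {V W : FDRep k G} [Simple V]
    (h : 0 < Module.finrank k (V ⟶ W)) : ∃ f : V ⟶ W, Mono f := by
  obtain ⟨f, hf⟩ := (Module.finrank_pos_iff_exists_ne_zero (R := k)).1 h
  exact ⟨f, mono_of_nonzero_from_simple hf⟩

lemma nonempty_iso_of_mono {V W : FDRep k G} [Simple V] [Simple W] (f : V ⟶ W) [Mono f] :
    Nonempty (V ≅ W) := by
  have hf : f ≠ 0 := fun h => Simple.not_isZero V (IsZero.of_mono_eq_zero f h)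
  have := isIso_of_hom_simple hf
  exact ⟨asIso f⟩

end Dual

section Filtration

variable {F : Type u} [Field F]

lemma tensorFiltration_mono {j k : ℕ} (h : j ≤ k) :
    tensorFiltration F j ≤ tensorFiltration F k := by
  refine AddSubgroup.closure_mono ?_
  rintro x ⟨W, L, hW, hL, h'⟩
  exact ⟨W, L, hW, hL.trans h, h'⟩

variable [Finite F] {V : FDRep ℂ (SL2 F)} [Simple V]

lemma repClass_mem_tensorFiltration_iff {k : ℕ} :
    repClass V ∈ tensorFiltration F k ↔ ∃ L : List (FDRep ℂ (SL2 F)), L.length ≤ k ∧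
      (∀ W ∈ L, IsHalfIrrep W) ∧ ∃ f : V ⟶ tensorList L, Mono f := by
  constructor
  · intro h
    have h' : repClass V ∈ AddSubgroup.closure {x | ∃ W : FDRep ℂ (SL2 F),
        (Simple W ∧ ∃ L : List (FDRep ℂ (SL2 F)), L.length ≤ k ∧
          (∀ V ∈ L, IsHalfIrrep V) ∧ ∃ f : W ⟶ tensorList L, Mono f) ∧ x = repClass W} := by
      refine AddSubgroup.closure_mono ?_ h
      rintro x ⟨W, L, hW, hk, hL, hf, hx⟩
      exact ⟨W, ⟨hW, L, hk, hL, hf⟩, hx⟩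
    obtain ⟨W, ⟨-, L, hk, hL, f, hf⟩, ⟨e⟩⟩ :=
      exists_iso_of_repClass_mem_closure (fun W hW => hW.1) h'
    exact ⟨L, hk, hL, e.hom ≫ f, mono_comp _ _⟩
  · rintro ⟨L, hk, hL, hf⟩
    exact AddSubgroup.subset_closure ⟨V, L, inferInstance, hk, hL, hf, rfl⟩

lemma repClass_mem_tensorFiltration_zero_iff :
    repClass V ∈ tensorFiltration F 0 ↔ Nonempty (V ≅ 𝟙_ (FDRep ℂ (SL2 F))) := by
  rw [repClass_mem_tensorFiltration_iff]
  constructor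
  · rintro ⟨L, hL, -, f, hf⟩
    obtain rfl := List.length_eq_zero_iff.1 (Nat.le_zero.1 hL)
    exact @nonempty_iso_of_mono _ _ _ _ V (𝟙_ (FDRep ℂ (SL2 F))) _ _ f hf
  · rintro ⟨e⟩
    exact ⟨[], le_rfl, by simp, e.hom, inferInstanceAs (Mono (Y := 𝟙_ (FDRep ℂ (SL2 F))) e.hom)⟩

lemma repClass_mem_tensorFiltration_one_iff : repClass V ∈ tensorFiltration F 1 ↔
    Nonempty (V ≅ 𝟙_ (FDRep ℂ (SL2 F))) ∨ IsHalfIrrep V := by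
  constructor
  · rw [repClass_mem_tensorFiltration_iff]
    rintro ⟨- | ⟨A, - | ⟨B, L⟩⟩, hL, half, f, hf⟩
    · exact .inl (@nonempty_iso_of_mono _ _ _ _ V (𝟙_ (FDRep ℂ (SL2 F))) _ _ f hf)
    · obtain ⟨hA, finrank_A⟩ := half A (by simp)
      let g : V ⟶ A ⊗ 𝟙_ (FDRep ℂ (SL2 F)) := f
      have : Mono g := hf
      have : Mono (g ≫ (ρ_ A).hom) := mono_comp g (ρ_ A).hom
      obtain ⟨e⟩ := nonempty_iso_of_mono (g ≫ (ρ_ A).hom)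
      exact .inr ⟨inferInstance, finrank_eq_of_iso e ▸ finrank_A⟩
    · simp at hL
  · rintro (trivial | half)
    · exact tensorFiltration_mono zero_le_one (repClass_mem_tensorFiltration_zero_iff.2 trivial)
    · exact repClass_mem_tensorFiltration_iff.2
        ⟨[V], le_rfl, by simpa using half, (ρ_ V).inv, inferInstanceAs (Mono (ρ_ V).inv)⟩

lemma repClass_mem_tensorFiltration_two_of_finrank_pos {X Y : FDRep ℂ (SL2 F)}
    (hX : IsHalfIrrep X) (hY : IsHalfIrrep Y) (h : 0 < Module.finrank ℂ (Y ⟶ V ⊗ X)) :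
    repClass V ∈ tensorFiltration F 2 := by
  have := hX.1
  have hX' : IsHalfIrrep (FDRep.of (Representation.dual X.ρ)) :=
    ⟨simple_dual X, by rw [finrank_dual]; exact hX.2⟩
  rw [← finrank_hom_tensor_dual] at h
  obtain ⟨f, hf⟩ := exists_mono_of_finrank_pos h
  let X' := FDRep.of (Representation.dual X.ρ)
  refine repClass_mem_tensorFiltration_iff.2 ⟨[Y, X'], le_rfl, ?_, f ≫ Y ◁ (ρ_ X').inv,
    inferInstanceAs (Mono (f ≫ Y ◁ (ρ_ X').inv))⟩
  simpa only [List.mem_cons, List.not_mem_nil, or_false, forall_eq_or_imp, forall_eq]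
    using ⟨hY, hX'⟩

end Filtration

section HalfRepresentations

variable {F : Type u} [Field F] {ψ : AddChar F ℂ} {ε : F}

lemma finrank_cases [Fintype F] (hψ : ψ.IsPrimitive) (hε : ¬ IsSquare ε)
    (V : FDRep ℂ (SL2 F)) [Simple V] :
    (Nonempty (V ≅ 𝟙_ (FDRep ℂ (SL2 F))) ∧ unipMult ψ 1 V = unipMult ψ ε V) ∨
    ((Module.finrank ℂ V = (Fintype.card F - 1) / 2 ∨
      Module.finrank ℂ V = (Fintype.card F + 1) / 2) ∧ unipMult ψ 1 V ≠ unipMult ψ ε V) ∨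
    ((Module.finrank ℂ V = Fintype.card F - 1 ∨ Module.finrank ℂ V = Fintype.card F ∨
      Module.finrank ℂ V = Fintype.card F + 1) ∧ unipMult ψ 1 V = unipMult ψ ε V) := by
  have finrank_eq := two_mul_finrank hψ hε V
  have odd_card := FiniteField.odd_card_of_char_ne_two (ringChar_ne_two_of_not_isSquare hε)
  have card_ge := three_le_card hε
  rcases classification hψ hε V with trivial | ⟨h0, add_eq_one⟩ | ⟨h0, h1, hε1, -⟩
  · obtain ⟨e⟩ := id trivial
    refine .inl ⟨trivial, ?_⟩
    have finrank_one := finrank_eq_one_of_iso_trivial trivial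
    have borelMult_pos : 0 < borelMult 1 V := borelMult_congr e 1 ▸ borelMult_trivial
    rw [finrank_one, unipMult_zero_eq_one (mul_one 1) borelMult_pos, left_eq_add,
      mul_eq_zero] at finrank_eq
    omega
  · refine .inr (.inl ⟨?_, by omega⟩)
    have add_eq_one' : (unipMult ψ 1 V : ℤ) + unipMult ψ ε V = 1 := by exact_mod_cast add_eq_one
    rw [add_eq_one', mul_one] at finrank_eq
    omega
  · refine .inr (.inr ⟨?_, h1.trans hε1.symm⟩)
    rw [h1, hε1] at finrank_eq
    push_cast at finrank_eq
    omega

lemma isHalfIrrep_of_unipMult_ne [Finite F] (hψ : ψ.IsPrimitive) (hε : ¬ IsSquare ε)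
    {V : FDRep ℂ (SL2 F)} [Simple V] (h : unipMult ψ 1 V ≠ unipMult ψ ε V) : IsHalfIrrep V := by
  have := Fintype.ofFinite F
  rw [IsHalfIrrep, Nat.card_eq_fintype_card]
  rcases finrank_cases hψ hε V with ⟨-, eq⟩ | ⟨finrank_eq, -⟩ | ⟨-, eq⟩
  · exact absurd eq h
  · exact ⟨inferInstance, finrank_eq⟩
  · exact absurd eq h

end HalfRepresentations

section TensorRankTwo

variable {F : Type u} [Field F] {ψ : AddChar F ℂ} {ε : F} {V X : FDRep ℂ (SL2 F)}

variable [Finite F]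

lemma unipMult_tensor_of_eq_one (hψ : ψ.IsPrimitive) (h : ∀ a ≠ 0, unipMult ψ a V = 1) (c : F) :
    (unipMult ψ c (V ⊗ X) : ℤ) =
      (unipMult ψ 0 V - 1) * unipMult ψ c X + Module.finrank ℂ X := by
  classical
  have := Fintype.ofFinite F
  have unipMult_V (a : F) :
      (unipMult ψ a V : ℤ) = 1 + if a = 0 then (unipMult ψ 0 V : ℤ) - 1 else 0 := by
    split_ifs with ha
    · rw [ha]; ring
    · rw [h a ha]; simp
  calc (unipMult ψ c (V ⊗ X) : ℤ)
      = ∑ a : F, (unipMult ψ a V : ℤ) * unipMult ψ (c - a) X := by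
        exact_mod_cast unipMult_tensor hψ c V X
    _ = ∑ a : F, (unipMult ψ (c - a) X : ℤ) + (unipMult ψ 0 V - 1) * unipMult ψ c X := by
        generalize (unipMult ψ 0 V : ℤ) = m at unipMult_V ⊢
        simp only [unipMult_V, add_mul, one_mul, Finset.sum_add_distrib, ite_mul, zero_mul,
          Finset.sum_ite_eq', Finset.mem_univ, if_true, sub_zero]
    _ = (unipMult ψ 0 V - 1) * unipMult ψ c X + ∑ a : F, (unipMult ψ a X : ℤ) := by
        rw [add_comm, ← Equiv.sum_comp (Equiv.subLeft c) fun a => (unipMult ψ a X : ℤ)]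
        rfl
    _ = _ := by rw [finrank_eq_sum_unipMult hψ X, Nat.cast_sum]

lemma exists_unipMult_ne_irrep {W : FDRep ℂ (SL2 F)} (h : unipMult ψ 1 W ≠ unipMult ψ ε W) :
    ∃ j : Irr ℂ (SL2 F), unipMult ψ 1 (irrep j) ≠ unipMult ψ ε (irrep j) ∧
      0 < Module.finrank ℂ (irrep j ⟶ W) := by
  contrapose! h
  rw [unipMult_eq_sum, unipMult_eq_sum]
  refine Finset.sum_congr rfl fun j _ => ?_
  by_cases hj : unipMult ψ 1 (irrep j) = unipMult ψ ε (irrep j)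
  · rw [hj]
  · rw [Nat.le_zero.1 (h j hj), zero_mul, zero_mul]

lemma repClass_mem_tensorFiltration_two_of_unipMult_zero_ne_one (hψ : ψ.IsPrimitive)
    (hε : ¬ IsSquare ε) [Simple V] (h0 : unipMult ψ 0 V ≠ 1) (h1 : unipMult ψ 1 V = 1)
    (hε1 : unipMult ψ ε V = 1) : repClass V ∈ tensorFiltration F 2 := by
  have := Fintype.ofFinite F
  obtain ⟨i, hi⟩ := Finset.card_pos.1 (card_unipMult_ne hψ hε ▸ four_pos)
  rw [Finset.mem_filter_univ] at hi
  have eq_one (a : F) (ha0 : a ≠ 0) : unipMult ψ a V = 1 := by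
    by_cases ha : IsSquare a
    · rw [unipMult_eq_of_isSquare ha0 ha, h1]
    · rw [unipMult_eq_of_not_isSquare hε ha, hε1]
  have tensor_ne : unipMult ψ 1 (V ⊗ irrep i) ≠ unipMult ψ ε (V ⊗ irrep i) := fun h => hi <| by
    zify at h h0 ⊢
    rw [unipMult_tensor_of_eq_one hψ eq_one, unipMult_tensor_of_eq_one hψ eq_one,
      add_left_inj] at h
    exact mul_left_cancel₀ (sub_ne_zero.2 h0) h
  obtain ⟨j, hj, hom_pos⟩ := exists_unipMult_ne_irrep tensor_ne
  exact repClass_mem_tensorFiltration_two_of_finrank_pos (isHalfIrrep_of_unipMult_ne hψ hε hi)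
    (isHalfIrrep_of_unipMult_ne hψ hε hj) hom_pos

variable (F) in
lemma exists_unitsChar_mul_self_eq_one (hF : ringChar F ≠ 2) :
    ∃ χ : Fˣ →* ℂ, χ * χ = 1 ∧ χ ≠ 1 := by
  classical
  have := Fintype.ofFinite F
  let χ : MulChar F ℂ := (quadraticChar F).ringHomComp (Int.castRingHom ℂ)
  have χ_apply (t : Fˣ) : χ t = (quadraticChar F t : ℤ) := rfl
  obtain ⟨t, ht⟩ := quadraticChar_exists_neg_one' hF
  refine ⟨(χ : F →* ℂ).comp (Units.coeHom F), MonoidHom.ext fun t => ?_, fun h => ?_⟩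
  · change χ t * χ t = 1
    rw [χ_apply, ← sq, ← Int.cast_pow, quadraticChar_sq_one t.ne_zero, Int.cast_one]
  · have : χ t = 1 := DFunLike.congr_fun h t
    rw [χ_apply, ht] at this
    norm_num at this

lemma repClass_mem_tensorFiltration_two_of_borelMult_one_pos (hψ : ψ.IsPrimitive)
    (hε : ¬ IsSquare ε) [Simple V] (hV : 0 < borelMult 1 V) :
    repClass V ∈ tensorFiltration F 2 := by
  have := Fintype.ofFinite F
  obtain ⟨χ, hχχ, hχ⟩ := exists_unitsChar_mul_self_eq_one F (ringChar_ne_two_of_not_isSquare hε)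
  have isHalfIrrep {W : FDRep ℂ (SL2 F)} [Simple W] (hW : 0 < borelMult χ W) : IsHalfIrrep W := by
    have add_eq_one := unipMult_add_of_quadratic hψ hε hχχ hχ hW
    exact isHalfIrrep_of_unipMult_ne hψ hε (by omega)
  obtain ⟨i, j, -, borelMult_eq_one_iff, -⟩ := exists_pair_of_mul_self_eq_one hχχ
  have hi : 0 < borelMult χ (irrep i) :=
    zero_lt_one.trans_eq ((borelMult_eq_one_iff i).2 (.inl rfl)).symm
  have tensor_pos : 0 < borelMult χ (V ⊗ irrep i) := by
    rw [← one_mul χ]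
    exact borelMult_tensor_pos hV hi
  rw [borelMult_eq_sum] at tensor_pos
  obtain ⟨j, -, hj⟩ := Finset.exists_ne_zero_of_sum_ne_zero tensor_pos.ne'
  exact repClass_mem_tensorFiltration_two_of_finrank_pos (isHalfIrrep hi)
    (isHalfIrrep (Nat.pos_of_ne_zero (right_ne_zero_of_mul hj)))
    (Nat.pos_of_ne_zero (left_ne_zero_of_mul hj))

end TensorRankTwo

section Rank

variable {F : Type u} [Field F] {V : FDRep ℂ (SL2 F)}

lemma hasTensorRank_succ_iff {k : ℕ} : HasTensorRank V (k + 1) ↔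
    repClass V ∈ tensorFiltration F (k + 1) ∧ repClass V ∉ tensorFiltration F k := by
  refine and_congr_right fun _ => ⟨fun h => h k rfl, fun h j hj => ?_⟩
  obtain rfl : k = j := Nat.succ_injective hj
  exact h

variable (F) in
lemma exists_isPrimitive_addChar [Finite F] : ∃ ψ : AddChar F ℂ, ψ.IsPrimitive := by
  obtain ⟨ψ, hψ⟩ := AddChar.exists_apply_ne_zero.2 (one_ne_zero (α := F))
  exact ⟨ψ, AddChar.IsPrimitive.of_ne_one (AddChar.ne_one_iff.2 ⟨1, hψ⟩)⟩

variable (F) in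
lemma ringChar_ne_two_of_odd_card [Finite F] (hF : Odd (Nat.card F)) : ringChar F ≠ 2 := fun h => by
  have := Fintype.ofFinite F
  rw [Nat.card_eq_fintype_card, Nat.odd_iff] at hF
  have := FiniteField.even_card_of_char_two h
  omega

variable [Finite F]

lemma hasTensorRank_zero_iff [Simple V] :
    HasTensorRank V 0 ↔ Nonempty (V ≅ 𝟙_ (FDRep ℂ (SL2 F))) := by
  rw [← repClass_mem_tensorFiltration_zero_iff]
  exact ⟨fun h => h.1, fun h => ⟨h, fun _ hj => absurd hj (Nat.succ_ne_zero _).symm⟩⟩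

lemma repClass_mem_tensorFiltration_two (hF : Odd (Nat.card F)) (V : FDRep ℂ (SL2 F)) [Simple V] :
    repClass V ∈ tensorFiltration F 2 := by
  obtain ⟨ψ, hψ⟩ := exists_isPrimitive_addChar F
  obtain ⟨ε, hε⟩ := FiniteField.exists_nonsquare (ringChar_ne_two_of_odd_card F hF)
  rcases classification hψ hε V with trivial | ⟨-, add_eq_one⟩ | ⟨-, h1, hε1, borelMult_pos⟩
  · exact tensorFiltration_mono zero_le_two (repClass_mem_tensorFiltration_zero_iff.2 trivial)
  · exact tensorFiltration_mono one_le_two <| repClass_mem_tensorFiltration_one_iff.2 <|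
      .inr (isHalfIrrep_of_unipMult_ne hψ hε (by omega))
  · by_cases h0 : unipMult ψ 0 V = 1
    · exact repClass_mem_tensorFiltration_two_of_borelMult_one_pos hψ hε (borelMult_pos h0)
    · exact repClass_mem_tensorFiltration_two_of_unipMult_zero_ne_one hψ hε h0 h1 hε1

variable (F) in
theorem tensorFiltration_two_eq_top (hF : Odd (Nat.card F)) : tensorFiltration F 2 = ⊤ := by
  rw [eq_top_iff, ← closure_repClass_eq_top, AddSubgroup.closure_le]
  rintro _ ⟨V, hV, rfl⟩
  exact repClass_mem_tensorFiltration_two hF V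

lemma hasTensorRank_one_iff [Simple V] : HasTensorRank V 1 ↔
    IsHalfIrrep V ∧ ¬ Nonempty (V ≅ 𝟙_ (FDRep ℂ (SL2 F))) := by
  rw [hasTensorRank_succ_iff, zero_add, repClass_mem_tensorFiltration_one_iff,
    repClass_mem_tensorFiltration_zero_iff]
  tauto

lemma hasTensorRank_two_iff (hF : Odd (Nat.card F)) [Simple V] : HasTensorRank V 2 ↔
    ¬ Nonempty (V ≅ 𝟙_ (FDRep ℂ (SL2 F))) ∧ ¬ IsHalfIrrep V := by
  rw [hasTensorRank_succ_iff, one_add_one_eq_two, repClass_mem_tensorFiltration_one_iff, not_or,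
    and_iff_right (repClass_mem_tensorFiltration_two hF V)]

lemma hasTensorRank_zero_or_one_or_two (hF : Odd (Nat.card F)) (V : FDRep ℂ (SL2 F)) [Simple V] :
    HasTensorRank V 0 ∨ HasTensorRank V 1 ∨ HasTensorRank V 2 := by
  rw [hasTensorRank_zero_iff, hasTensorRank_one_iff, hasTensorRank_two_iff hF]
  tauto

end Rank

section LargeField

variable {F : Type u} [Field F] [Finite F] {ψ : AddChar F ℂ} {ε : F}

lemma isHalfIrrep_iff_unipMult_ne (hψ : ψ.IsPrimitive) (hε : ¬ IsSquare ε) (hq : 3 < Nat.card F)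
    (V : FDRep ℂ (SL2 F)) [Simple V] :
    IsHalfIrrep V ↔ unipMult ψ 1 V ≠ unipMult ψ ε V := by
  have := Fintype.ofFinite F
  have odd_card := FiniteField.odd_card_of_char_ne_two (ringChar_ne_two_of_not_isSquare hε)
  refine ⟨fun half => ?_, isHalfIrrep_of_unipMult_ne hψ hε⟩
  have finrank_eq := half.2
  rw [Nat.card_eq_fintype_card] at hq finrank_eq
  rcases finrank_cases hψ hε V with ⟨trivial, -⟩ | ⟨-, ne⟩ | ⟨finrank_eq', -⟩
  · have finrank_one := finrank_eq_one_of_iso_trivial trivial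
    omega
  · exact ne
  · omega

lemma ncard_isHalfIrrep (hF : Odd (Nat.card F)) (hq : 3 < Nat.card F) :
    {x : Skeleton (FDRep ℂ (SL2 F)) | ∃ V, IsHalfIrrep V ∧ x = toSkeleton V}.ncard = 4 := by
  obtain ⟨ψ, hψ⟩ := exists_isPrimitive_addChar F
  obtain ⟨ε, hε⟩ := FiniteField.exists_nonsquare (ringChar_ne_two_of_odd_card F hF)
  rw [← card_unipMult_ne hψ hε, ← Set.ncard_coe_finset, eq_comm]
  refine Set.ncard_congr (fun i _ => toSkeleton (irrep i)) (fun i hi => ?_) (fun i j _ _ h => ?_)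
    fun x hx => ?_
  · rw [Finset.mem_coe, Finset.mem_filter_univ] at hi
    exact ⟨irrep i, isHalfIrrep_of_unipMult_ne hψ hε hi, rfl⟩
  · exact nonempty_irrep_iso_iff.1 (toSkeleton_eq_toSkeleton_iff.1 h)
  · obtain ⟨V, hV, rfl⟩ := hx
    have := hV.1
    obtain ⟨i, ⟨e⟩⟩ := exists_iso_irrep V
    refine ⟨i, ?_, toSkeleton_eq_toSkeleton_iff.2 ⟨e.symm⟩⟩
    rw [Finset.mem_coe, Finset.mem_filter_univ, ← unipMult_congr e, ← unipMult_congr e]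
    exact (isHalfIrrep_iff_unipMult_ne hψ hε hq V).1 hV

lemma finrank_cases_of_not_isHalfIrrep (hF : Odd (Nat.card F)) {V : FDRep ℂ (SL2 F)} [Simple V]
    (hV : ¬ Nonempty (V ≅ 𝟙_ (FDRep ℂ (SL2 F)))) (half : ¬ IsHalfIrrep V) :
    Module.finrank ℂ V = Nat.card F - 1 ∨ Module.finrank ℂ V = Nat.card F ∨
      Module.finrank ℂ V = Nat.card F + 1 := by
  have := Fintype.ofFinite F
  obtain ⟨ψ, hψ⟩ := exists_isPrimitive_addChar F
  obtain ⟨ε, hε⟩ := FiniteField.exists_nonsquare (ringChar_ne_two_of_odd_card F hF)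
  rw [Nat.card_eq_fintype_card]
  rcases finrank_cases hψ hε V with ⟨trivial, -⟩ | ⟨-, ne⟩ | ⟨finrank_eq, -⟩
  · exact absurd trivial hV
  · exact absurd (isHalfIrrep_of_unipMult_ne hψ hε ne) half
  · exact finrank_eq

lemma hasTensorRank_one_iff_finrank (hF : Odd (Nat.card F)) (hq : 3 < Nat.card F)
    (V : FDRep ℂ (SL2 F)) [Simple V] :
    HasTensorRank V 1 ↔ Module.finrank ℂ V = (Nat.card F - 1) / 2 ∨
      Module.finrank ℂ V = (Nat.card F + 1) / 2 := by
  rw [hasTensorRank_one_iff, IsHalfIrrep, and_iff_right ‹Simple V›, and_iff_left_iff_imp]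
  intro half trivial
  have finrank_one := finrank_eq_one_of_iso_trivial trivial
  rw [Nat.odd_iff] at hF
  omega

lemma hasTensorRank_two_iff_finrank (hF : Odd (Nat.card F)) (hq : 3 < Nat.card F)
    (V : FDRep ℂ (SL2 F)) [Simple V] :
    HasTensorRank V 2 ↔ Module.finrank ℂ V = Nat.card F - 1 ∨
      Module.finrank ℂ V = Nat.card F ∨ Module.finrank ℂ V = Nat.card F + 1 := by
  rw [hasTensorRank_two_iff hF]
  refine ⟨fun h => finrank_cases_of_not_isHalfIrrep hF h.1 h.2,
    fun finrank_eq => ⟨fun trivial => ?_, fun half => ?_⟩⟩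
  · have finrank_one := finrank_eq_one_of_iso_trivial trivial
    omega
  · have finrank_half := half.2
    rw [Nat.odd_iff] at hF
    omega

end LargeField

end

end TensorRank

open TensorRank in
theorem proposition2p1 {F : Type*} [Field F] [Finite F] (q : ℕ) (hq : Nat.card F = q)
    (hodd : Odd q) :
    (tensorFiltration F 2 = ⊤) ∧
    (∀ V : FDRep ℂ (SL2 F), Simple V →
      (HasTensorRank V 0 ∨ HasTensorRank V 1 ∨ HasTensorRank V 2) ∧
      (HasTensorRank V 0 ↔ Nonempty (V ≅ 𝟙_ (FDRep ℂ (SL2 F))))) ∧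
    (3 < q →
      {x : Skeleton (FDRep ℂ (SL2 F)) | ∃ V, IsHalfIrrep V ∧ x = toSkeleton V}.ncard = 4 ∧
      ∀ V : FDRep ℂ (SL2 F), Simple V →
        (HasTensorRank V 1 ↔
          Module.finrank ℂ V = (q - 1) / 2 ∨ Module.finrank ℂ V = (q + 1) / 2) ∧
        (HasTensorRank V 2 ↔
          Module.finrank ℂ V = q - 1 ∨ Module.finrank ℂ V = q ∨
            Module.finrank ℂ V = q + 1)) := by
  subst hq
  refine ⟨tensorFiltration_two_eq_top F hodd, fun V hV => ⟨?_, hasTensorRank_zero_iff⟩,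
    fun hq => ⟨ncard_isHalfIrrep hodd hq, fun V hV => ⟨?_, ?_⟩⟩⟩
  · exact hasTensorRank_zero_or_one_or_two hodd V
  · exact hasTensorRank_one_iff_finrank hodd hq V
  · exact hasTensorRank_two_iff_finrank hodd hq V
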